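/- Let $\mathscr Q_n=\{Q=0\}$ be a non-singular quadric of $\mathrm{PG}(n,2)$ (that is, $Q$ is a quadratic form over $\mathbb F_2$ in $n+1$ variables that no linear change of coordinates reduces to fewer variables). Let $g$ be its projective index, the largest projective dimension of a subspace contained in $\mathscr Q_n$, and assume $g\ge 1$. If $n=2r$, the quadric is called parabolic, $\mathscr Q_n=\mathcal P_{2r}$ (and $g=r-1$). If $n=2r+1$, it is called elliptic, $\mathscr Q_n=\mathcal E_{2r+1}$, when $g=r-1$, and hyperbolic, $\mathscr Q_n=\mathcal H_{2r+1}$, when $g=r$. Let $\Gamma$ be the point-graph of $\mathscr Q_n$: its vertices are the points of $\mathscr Q_n$, two distinct points being adjacent when they lie on a line contained in $\mathscr Q_n$. For $0\le s<g$ let $\alpha_s$ be an $s$-dimensional subspace contained in $\mathscr Q_n$, and let $\mathcal X_s$ be the set of points of $\mathscr Q_n\setminus\alpha_s$ that lie in some $(s+1)$-dimensional subspace $\Pi$ with $\alpha_s\subset\Pi\subset\mathscr Q_n$. Let $\Gamma_s$ be the graph obtained from $\Gamma$ by the Godsil–McKay construction with respect to $\mathcal X_s$: for every vertex $R\notin\mathcal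 X_s$ adjacent to exactly $\frac12|\mathcal X_s|$ vertices of $\mathcal X_s$, delete these $\frac12|\mathcal X_s|$ edges and join $R$ to the other $\frac12|\mathcal X_s|$ vertices of $\mathcal X_s$; keep all other edges and non-edges. A maximum clique of a graph is a clique of the largest possible size in that graph. For every choice of $s$ with $0\le s<g$ and of $\alpha_s$: 1. If $\mathscr Q_n=\mathcal E_{2r+1}$, then (a) $\Gamma$ has $(2^2+1)(2^3+1)\cdots(2^{r+1}+1)$ maximum cliques; (b) $\Gamma_s$ has $(2^2+1)(2^3+1)\cdots(2^{r-s}+1)\times\big(2^{r+2}-2^{r-s+1}+1\big)$ maximum cliques. 2. If $\mathscr Q_n=\mathcal H_{2r+1}$, then (a) $\Gamma$ has $(2^0+1)(2^1+1)\cdots(2^{r}+1)$ maximum cliques; (b) $\Gamma_s$ has $(2^0+1)(2^1+1)\cdots(2^{r-s-1}+1)\times\big(2^{r+1}-2^{r-s}+1\big)$ maximum cliques. 3. If $\mathscr Q_n=\mathcal P_{2r}$, then (a) $\Gamma$ has $(2^1+1)(2^2+1)\cdots(2^{r}+1)$ maximum cliques; (b) $\Gamma_s$ has $(2^1+1)(2^2+1)\cdots(2^{r-s-1}+1)\times\big(2^{r+1}-2^{r-s}+1\big)$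 maximum cliques. Moreover, in 1(a), 2(a) and 3(a) the number of cliques of $\Gamma$ that are maximal under inclusion is also equal to the given number. -/

import Mathlib

open scoped LinearAlgebra.Projectivization

namespace QuadricGraph

variable {K V : Type*} [Field K] [AddCommGroup V] [Module K V]

/-- The subspace `W` of the projective space `PG(V)` is contained in the quadric `Q = 0`. -/
def Contained (Q : QuadraticForm K V) (W : Submodule K V) : Prop :=
  ∀ v ∈ W, Q v = 0

/-- `W` is a `k`-space (a subspace of projective dimension `k`, that is, of vector space dimension
`k + 1`) contained in the quadric `Q = 0`. -/
def IsSpaceOn (Q : QuadraticForm K V) (k : ℕ) (W : Submodule K V) : Prop :=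
  Module.finrank K W = k + 1 ∧ Contained Q W

/-- The quadric `Q = 0` is non-singular: `Q` does not factor through a proper quotient of `V`
(it cannot be written in fewer variables); equivalently there is no `v ≠ 0` with `Q v = 0` and
`Q (v + w) = Q w` for all `w`. -/
def IsNonsingular (Q : QuadraticForm K V) : Prop :=
  Q.radical = ⊥

/-- `g` is the projective index of the quadric `Q = 0`: the largest projective dimension of a
subspace contained in it. -/
def IsProjectiveIndex (Q : QuadraticForm K V) (g : ℕ) : Prop :=
  IsGreatest {k : ℕ | ∃ W : Submodule K V, IsSpaceOn Q k W} g

/-- `Q = 0` is an elliptic quadric of `PG(2r+1, q)`: the non-singular quadrics of projective index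
`r - 1`. -/
def IsElliptic (Q : QuadraticForm K V) (r : ℕ) : Prop :=
  Module.finrank K V = (2 * r + 1) + 1 ∧ IsNonsingular Q ∧ 1 ≤ r ∧ IsProjectiveIndex Q (r - 1)

/-- `Q = 0` is a hyperbolic quadric of `PG(2r+1, q)`: the non-singular quadrics of projective index
`r`. -/
def IsHyperbolic (Q : QuadraticForm K V) (r : ℕ) : Prop :=
  Module.finrank K V = (2 * r + 1) + 1 ∧ IsNonsingular Q ∧ IsProjectiveIndex Q r

/-- `Q = 0` is a parabolic quadric: a non-singular quadric of `PG(2r, q)`. -/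
def IsParabolic (Q : QuadraticForm K V) (r : ℕ) : Prop :=
  Module.finrank K V = 2 * r + 1 ∧ IsNonsingular Q

/-- The points of the projective space that lie on the quadric `Q = 0`. -/
abbrev Point (Q : QuadraticForm K V) : Type _ :=
  {P : ℙ K V // Contained Q P.submodule}

/-- The point-graph of a quadric: two distinct points are adjacent when they lie on a line
contained in the quadric. -/
def pointGraph (Q : QuadraticForm K V) : SimpleGraph (Point Q) where
  Adj P P' := P ≠ P' ∧ ∃ l : Submodule K V,
    IsSpaceOn Q 1 l ∧ P.1.submodule ≤ l ∧ P'.1.submodule ≤ l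
  symm := ⟨fun _ _ ⟨h, l, hl, h1, h2⟩ => ⟨h.symm, l, hl, h2, h1⟩⟩
  loopless := ⟨fun _ h => h.1 rfl⟩

/-- For an `s`-space `α` contained in the quadric, the points of the quadric outside `α` that lie in
some `(s+1)`-space `Π` with `α ⊂ Π` contained in the quadric (the points "of type (ii)"). -/
def typeTwo (Q : QuadraticForm K V) (s : ℕ) (α : Submodule K V) : Set (Point Q) :=
  {P | ¬ P.1.submodule ≤ α ∧
    ∃ W : Submodule K V, IsSpaceOn Q (s + 1) W ∧ α ≤ W ∧ P.1.submodule ≤ W}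

/-- `x ∈ X`, and `y ∉ X` has exactly half of the vertices of `X` as neighbours. -/
def HalfJoined {U : Type*} (G : SimpleGraph U) (X : Set U) (x y : U) : Prop :=
  x ∈ X ∧ y ∉ X ∧ 2 * (G.neighborSet y ∩ X).ncard = X.ncard

/-- The graph obtained from `G` by the Godsil-McKay construction with the partition `{X, Xᶜ}`:
for every vertex `y ∉ X` that is adjacent to exactly half of `X`, adjacency between `y` and the
vertices of `X` is complemented; all the other pairs of vertices keep their adjacency. -/
def godsilMcKay {U : Type*} (G : SimpleGraph U) (X : Set U) : SimpleGraph U where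
  Adj u v := Xor (G.Adj u v) (HalfJoined G X u v ∨ HalfJoined G X v u)
  symm := ⟨fun u v h => by rwa [G.adj_comm v u, or_comm]⟩
  loopless := ⟨fun u h => by
    rcases h with ⟨h, -⟩ | ⟨⟨h1, h2, -⟩ | ⟨h1, h2, -⟩, -⟩
    · exact G.loopless.irrefl u h
    · exact h2 h1
    · exact h2 h1⟩

/-- The graph `Γ_s` built from the `s`-space `α` contained in the quadric `Q = 0`. -/
def switchedGraph (Q : QuadraticForm K V) (s : ℕ) (α : Submodule K V) :
    SimpleGraph (Point Q) :=
  godsilMcKay (pointGraph Q) (typeTwo Q s α)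

/-- The number of maximum cliques (cliques of the largest possible size) of a finite graph. -/
noncomputable def numMaximumCliques {U : Type*} [Finite U] (G : SimpleGraph U) : ℕ :=
  {C : Finset U | G.IsMaximumClique C}.ncard

/-- The number of inclusion-maximal cliques of a finite graph. -/
noncomputable def numInclusionMaximalCliques {U : Type*} [Finite U] (G : SimpleGraph U) : ℕ :=
  {C : Set U | Maximal G.IsClique C}.ncard

end QuadricGraph

/-!
Over `𝔽₂` a point of the quadric is a non-zero singular vector, and two points are adjacent exactly
when the vectors are orthogonal for the polar form. Let `m = g + 1` be the Witt index, and write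
`dim V = 2 m + e`. Then `e = 2, 0, 1` in the elliptic, hyperbolic and parabolic case: in the first two
the index is given, and in the last one `e` is odd and at most two, since an anisotropic form over
`𝔽₂` has dimension at most two (`HasWittIndex.finrank_le_two_mul_add_two`).

*The point-graph.* A clique spans a totally singular subspace, and all maximal totally singular
subspaces have dimension `m`, so the inclusion-maximal cliques and the maximum cliques are both the
sets `M \ {0}` for generators `M`. Generators through a totally singular subspace of codimension `k`
in a generator are counted by induction on `k` (`ncard_generators`), starting from the number of
singular vectors of its orthogonal space (`two_mul_ncard_singular_perp`); there are
`∏ i < k, (2 ^ (e + i) + 1)` of them.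

*The switched graph.* Let `X` be the singular vectors of `α^⊥` outside `α`, and `Y` those outside
`α^⊥`. The vertices outside `X` joined to half of `X` are those of `Y` (`halfJoined_iff`), so
switching complements adjacency between `X` and `Y`. A clique of the switched graph avoiding `X` or
`Y` is a clique of the point-graph, and a maximum one is a generator through `α`. In a clique that
meets both, `y ∈ Y` defines a functional on a generator `T ⊇ α`; estimating the parts in `X`, `α` and
`Y` separately gives again at most `2 ^ m - 1` vertices, and equality leaves only the sets
`switchedClique Q α T y` (`IsVectorClique.mixed`). Such a set determines `T`, and it determines `y` up
to a coset of the hyperplane `T ∩ y^⊥` of `T` (`switchedClique_eq_iff`). Each generator `T ⊇ α`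
therefore contributes `1 + |Y| / 2 ^ (m - 1) = 1 + 2 ^ (e + m) - 2 ^ (e + m - dim α)` maximum cliques.
-/

namespace QuadricGraph

open QuadraticMap Module

/-! ### Halving finite sets -/

/-- An involution of a finite set `A` that exchanges the elements satisfying `p` with those that do
not shows that exactly half of the elements of `A` satisfy `p`. -/
lemma two_mul_ncard_sep_of_involution {U : Type*} {A : Set U} (hA : A.Finite) {p : U → Prop}
    (σ : U → U) (hσA : ∀ x ∈ A, σ x ∈ A) (hσσ : ∀ x ∈ A, σ (σ x) = x)
    (hσp : ∀ x ∈ A, (p (σ x) ↔ ¬ p x)) : 2 * {x ∈ A | p x}.ncard = A.ncard := by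
  have h1 : {x ∈ A | p x}.ncard = {x ∈ A | ¬ p x}.ncard := by
    refine Set.ncard_congr (fun x _ => σ x) ?_ ?_ ?_
    · rintro x ⟨hx, hpx⟩
      exact ⟨hσA x hx, fun h => (hσp x hx).1 h hpx⟩
    · rintro x y ⟨hx, -⟩ ⟨hy, -⟩ h
      rw [← hσσ x hx, ← hσσ y hy]
      exact congrArg σ h
    · rintro x ⟨hx, hpx⟩
      exact ⟨σ x, ⟨hσA x hx, (hσp x hx).2 hpx⟩, hσσ x hx⟩
  have h2 : A = {x ∈ A | p x} ∪ {x ∈ A | ¬ p x} := by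
    ext x; by_cases h : p x <;> simp [h]
  have h3 : Disjoint {x ∈ A | p x} {x ∈ A | ¬ p x} := by
    rw [Set.disjoint_left]; rintro x ⟨-, h⟩ ⟨-, h'⟩; exact h' h
  conv_rhs => rw [h2, Set.ncard_union_eq h3 (hA.subset (Set.sep_subset _ _))
    (hA.subset (Set.sep_subset _ _)), ← h1]
  ring

section

variable {V : Type*} [AddCommGroup V] [Module (ZMod 2) V]

lemma zmod_two_ne_zero_iff {a : ZMod 2} : a ≠ 0 ↔ a = 1 := by
  revert a; decide

lemma add_self_eq_zero_of_zmod_two (v : V) : v + v = 0 := by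
  rw [← two_smul (ZMod 2) v, show (2 : ZMod 2) = 0 from rfl, zero_smul]

lemma add_add_cancel_of_zmod_two (v w : V) : v + w + w = v := by
  rw [add_assoc, add_self_eq_zero_of_zmod_two, add_zero]

lemma mem_span_singleton_zmod_two {v w : V} :
    w ∈ Submodule.span (ZMod 2) {v} ↔ w = 0 ∨ w = v := by
  rw [Submodule.mem_span_singleton]
  constructor
  · rintro ⟨a, rfl⟩
    rcases eq_or_ne a 0 with rfl | h
    · simp
    · rw [zmod_two_ne_zero_iff.1 h]; simp
  · rintro (rfl | rfl)
    · exact ⟨0, zero_smul _ _⟩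
    · exact ⟨1, one_smul _ _⟩

lemma mem_sup_span_singleton_zmod_two {W : Submodule (ZMod 2) V} {v w : V} :
    w ∈ W ⊔ Submodule.span (ZMod 2) {v} ↔ w ∈ W ∨ w + v ∈ W := by
  rw [Submodule.mem_sup]
  constructor
  · rintro ⟨x, hx, y, hy, rfl⟩
    rcases mem_span_singleton_zmod_two.1 hy with rfl | rfl
    · left; simpa using hx
    · right; rwa [add_add_cancel_of_zmod_two]
  · rintro (h | h)
    · exact ⟨w, h, 0, zero_mem _, add_zero _⟩
    · exact ⟨w + v, h, v, Submodule.mem_span_singleton_self v, add_add_cancel_of_zmod_two _ _⟩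

variable {Q : QuadraticForm (ZMod 2) V}

lemma polar_self_eq_zero (v : V) : polar Q v v = 0 := by
  rw [polar_self, two_nsmul]
  exact CharTwo.add_self_eq_zero _

/-! ### Orthogonal spaces and totally singular subspaces -/

/-- The orthogonal space of `W` with respect to the polar form of `Q`. -/
def perp (Q : QuadraticForm (ZMod 2) V) (W : Submodule (ZMod 2) V) : Submodule (ZMod 2) V :=
  LinearMap.BilinForm.orthogonal Q.polarBilin W

lemma mem_perp {W : Submodule (ZMod 2) V} {v : V} :
    v ∈ perp Q W ↔ ∀ w ∈ W, polar Q w v = 0 :=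
  Iff.rfl

lemma perp_anti {W W' : Submodule (ZMod 2) V} (h : W ≤ W') : perp Q W' ≤ perp Q W :=
  fun _ hv w hw => hv w (h hw)

lemma exists_polar_eq_one {W : Submodule (ZMod 2) V} {v : V} (hv : v ∉ perp Q W) :
    ∃ w ∈ W, polar Q w v = 1 := by
  rw [mem_perp] at hv
  push Not at hv
  obtain ⟨w, hw, h⟩ := hv
  exact ⟨w, hw, zmod_two_ne_zero_iff.1 h⟩

lemma Contained.mono {W W' : Submodule (ZMod 2) V} (h : Contained Q W') (hW : W ≤ W') :
    Contained Q W := fun v hv => h v (hW hv)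

lemma Contained.polar_eq_zero {W : Submodule (ZMod 2) V} (h : Contained Q W) {v w : V}
    (hv : v ∈ W) (hw : w ∈ W) : polar Q v w = 0 := by
  simp [polar, h _ hv, h _ hw, h _ (add_mem hv hw)]

lemma Contained.le_perp {W : Submodule (ZMod 2) V} (h : Contained Q W) : W ≤ perp Q W :=
  fun _ hv _ hw => h.polar_eq_zero hw hv

lemma map_add_of_polar_eq_zero {v w : V} (h : polar Q v w = 0) : Q (v + w) = Q v + Q w := by
  rw [QuadraticMap.map_add Q, h, add_zero]

lemma contained_span {D : Set V} (h0 : ∀ v ∈ D, Q v = 0) (h : ∀ v ∈ D, ∀ w ∈ D, polar Q v w = 0) :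
    Contained Q (Submodule.span (ZMod 2) D) := by
  have h1 : ∀ v ∈ D, ∀ w ∈ Submodule.span (ZMod 2) D, polar Q v w = 0 := by
    intro v hv w hw
    induction hw using Submodule.span_induction with
    | mem x hx => exact h v hv x hx
    | zero => exact polar_zero_right _ _
    | add x y _ _ hx hy => rw [polar_add_right, hx, hy, add_zero]
    | smul a x _ hx => rw [polar_smul_right, hx, smul_zero]
  have h2 : ∀ v ∈ Submodule.span (ZMod 2) D, ∀ w ∈ Submodule.span (ZMod 2) D,
      polar Q v w = 0 := by
    intro w hw v hv
    rw [polar_comm]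
    induction hw using Submodule.span_induction with
    | mem x hx => rw [polar_comm]; exact h1 x hx v hv
    | zero => exact polar_zero_right _ _
    | add x y _ _ hx hy => rw [polar_add_right, hx, hy, add_zero]
    | smul a x _ hx => rw [polar_smul_right, hx, smul_zero]
  intro v hv
  induction hv using Submodule.span_induction with
  | mem x hx => exact h0 x hx
  | zero => exact QuadraticMap.map_zero _
  | add x y hx hy hx' hy' => rw [map_add_of_polar_eq_zero (h2 x hx y hy), hx', hy', add_zero]
  | smul a x _ hx => rw [QuadraticMap.map_smul, hx, smul_zero]

lemma Contained.sup_span_singleton {W : Submodule (ZMod 2) V} (h : Contained Q W) {v : V}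
    (hv : v ∈ perp Q W) (hv0 : Q v = 0) : Contained Q (W ⊔ Submodule.span (ZMod 2) {v}) := by
  intro x hx
  rcases mem_sup_span_singleton_zmod_two.1 hx with hx | hx
  · exact h x hx
  · have h1 : x = x + v + v := (add_add_cancel_of_zmod_two _ _).symm
    rw [h1, map_add_of_polar_eq_zero (hv _ hx), h _ hx, hv0, add_zero]

variable [Finite V]

lemma ncard_submodule (W : Submodule (ZMod 2) V) :
    (W : Set V).ncard = 2 ^ finrank (ZMod 2) W := by
  have := Module.natCard_eq_pow_finrank (K := ZMod 2) (V := W)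
  rw [Nat.card_zmod] at this
  rw [← this]
  rfl

lemma finrank_sup_span_singleton {W : Submodule (ZMod 2) V} {v : V} (hv : v ∉ W) :
    finrank (ZMod 2) ↥(W ⊔ Submodule.span (ZMod 2) {v}) = finrank (ZMod 2) W + 1 := by
  have hv0 : v ≠ 0 := fun h => hv (h ▸ zero_mem W)
  have h1 := Submodule.finrank_sup_add_finrank_inf_eq W (Submodule.span (ZMod 2) {v})
  have h2 : W ⊓ Submodule.span (ZMod 2) {v} = ⊥ := by
    rw [eq_bot_iff]
    rintro x ⟨hx, hx'⟩
    rcases mem_span_singleton_zmod_two.1 hx' with rfl | rfl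
    · exact zero_mem _
    · exact absurd hx hv
  rw [h2, finrank_bot, finrank_span_singleton hv0] at h1
  omega

/-- A totally singular subspace meets the radical of the polar form trivially when `Q` is
non-singular, so its orthogonal space has the expected dimension even if the polar form is
degenerate. -/
lemma Contained.finrank_add_finrank_perp {W : Submodule (ZMod 2) V} (h : Contained Q W)
    (hQ : IsNonsingular Q) :
    finrank (ZMod 2) W + finrank (ZMod 2) (perp Q W) = finrank (ZMod 2) V := by
  have h1 := LinearMap.BilinForm.finrank_add_finrank_orthogonal' (B := Q.polarBilin) W
  have h2 : W ⊓ LinearMap.ker Q.polarBilin = ⊥ := by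
    rw [eq_bot_iff, ← hQ]
    rintro x ⟨hx, hx'⟩
    exact ⟨h x hx, hx'⟩
  rw [h2, finrank_bot, add_zero] at h1
  exact h1

/-- The exchange property behind the equality of the dimensions of maximal totally singular
subspaces. -/
lemma exists_mem_perp_notMem (hQ : IsNonsingular Q) {M N : Submodule (ZMod 2) V}
    (hM : Contained Q M) (hN : Contained Q N)
    (h : finrank (ZMod 2) M < finrank (ZMod 2) N) : ∃ v ∈ N, v ∈ perp Q M ∧ v ∉ M := by
  by_contra! hcon
  have h1 := Submodule.finrank_sup_add_finrank_inf_eq N (perp Q M)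
  have h2 := hM.finrank_add_finrank_perp hQ
  have h3 := (hM.mono (inf_le_left : M ⊓ N ≤ M)).finrank_add_finrank_perp hQ
  have h4 : N ⊔ perp Q M ≤ perp Q (M ⊓ N) :=
    sup_le (hN.le_perp.trans (perp_anti inf_le_right)) (perp_anti inf_le_left)
  have h5 : N ⊓ perp Q M ≤ M ⊓ N := fun v hv => ⟨hcon v hv.1 hv.2, hv.1⟩
  have h6 := Submodule.finrank_mono h4
  have h7 := Submodule.finrank_mono h5
  omega

/-! ### Generators -/

/-- `Q` is non-singular of Witt index `m`: the largest (vector space) dimension of a totally singular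
subspace is `m`. -/
structure HasWittIndex (Q : QuadraticForm (ZMod 2) V) (m : ℕ) : Prop where
  nonsingular : IsNonsingular Q
  finrank_le : ∀ W, Contained Q W → finrank (ZMod 2) W ≤ m
  exists_finrank_eq : ∃ W, Contained Q W ∧ finrank (ZMod 2) W = m

/-- The generators of the quadric through `S`: the totally singular subspaces of dimension `m`
containing `S`. -/
def generators (Q : QuadraticForm (ZMod 2) V) (m : ℕ) (S : Submodule (ZMod 2) V) :
    Set (Submodule (ZMod 2) V) :=
  {M | Contained Q M ∧ finrank (ZMod 2) M = m ∧ S ≤ M}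

variable {m : ℕ}

lemma exists_generator (hQ : HasWittIndex Q m) {S : Submodule (ZMod 2) V} (hS : Contained Q S) :
    ∃ M, M ∈ generators Q m S := by
  obtain ⟨N, hN, hNm⟩ := hQ.exists_finrank_eq
  obtain ⟨k, hk⟩ : ∃ k, finrank (ZMod 2) S + k = m := ⟨_, Nat.add_sub_cancel' (hQ.finrank_le S hS)⟩
  induction k generalizing S with
  | zero => exact ⟨S, hS, by simpa using hk, le_rfl⟩
  | succ k ih =>
    obtain ⟨v, hvN, hv, hvS⟩ := exists_mem_perp_notMem hQ.nonsingular hS hN (by omega)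
    obtain ⟨M, h1, h2, h3⟩ := ih (hS.sup_span_singleton hv (hN v hvN))
      (by rw [finrank_sup_span_singleton hvS]; omega)
    exact ⟨M, h1, h2, le_sup_left.trans h3⟩

lemma mem_generator_of_mem_perp (hQ : HasWittIndex Q m) {S M : Submodule (ZMod 2) V}
    (hM : M ∈ generators Q m S) {v : V} (hv : v ∈ perp Q M) (hv0 : Q v = 0) : v ∈ M := by
  by_contra hvM
  have h1 := hQ.finrank_le _ (hM.1.sup_span_singleton hv hv0)
  rw [finrank_sup_span_singleton hvM, hM.2.1] at h1
  omega

/-- The number of singular vectors orthogonal to a totally singular subspace `S`: with `M` a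
generator through `S`, exactly half of the vectors of `S^⊥` outside `M^⊥` are singular, because
`Q` takes both values equally often on each coset of `M` there, and the singular vectors of `M^⊥`
are those of `M`. -/
lemma two_mul_ncard_singular_perp (hQ : HasWittIndex Q m) {S : Submodule (ZMod 2) V}
    (hS : Contained Q S) :
    2 * {v ∈ (perp Q S : Set V) | Q v = 0}.ncard + 2 ^ (finrank (ZMod 2) V - m) =
      2 * 2 ^ m + 2 ^ (finrank (ZMod 2) V - finrank (ZMod 2) S) := by
  obtain ⟨M, hM⟩ := exists_generator hQ hS
  have hle : perp Q M ≤ perp Q S := perp_anti hM.2.2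
  set A : Set V := (perp Q S : Set V) \ perp Q M with hA
  -- a shift vector in `M` for each coset of `M`
  have hshift : ∀ c : V ⧸ M, ∃ b ∈ M, ∀ v : V, Submodule.Quotient.mk v = c → v ∉ perp Q M →
      polar Q b v = 1 := by
    intro c
    obtain ⟨w, rfl⟩ := Submodule.Quotient.mk_surjective M c
    by_cases hw : w ∈ perp Q M
    · refine ⟨0, zero_mem _, fun v hv hv' => absurd ?_ hv'⟩
      rw [Submodule.Quotient.eq] at hv
      have := add_mem (hM.1.le_perp hv) hw
      simpa using this
    · obtain ⟨b, hb, hbw⟩ := exists_polar_eq_one hw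
      refine ⟨b, hb, fun v hv _ => ?_⟩
      rw [Submodule.Quotient.eq] at hv
      have := hM.1.polar_eq_zero hb hv
      rw [polar_sub_right, hbw, sub_eq_zero] at this
      exact this
  choose b hbM hb using hshift
  have hhalf : 2 * {v ∈ A | Q v = 0}.ncard = A.ncard := by
    have hmk : ∀ x, (Submodule.Quotient.mk (x + b (Submodule.Quotient.mk x)) : V ⧸ M) =
        Submodule.Quotient.mk x := by
      intro x
      rw [Submodule.Quotient.eq]
      simpa using hbM _
    refine two_mul_ncard_sep_of_involution A.toFinite
      (fun v => v + b (Submodule.Quotient.mk v)) ?_ ?_ ?_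
    · rintro x ⟨hx, hx'⟩
      refine ⟨add_mem hx (hle (hM.1.le_perp (hbM _))), fun h => hx' ?_⟩
      have := sub_mem h (hM.1.le_perp (hbM (Submodule.Quotient.mk x)))
      simpa using this
    · intro x _
      rw [hmk, add_add_cancel_of_zmod_two]
    · rintro x ⟨-, hx'⟩
      have := hb _ x rfl hx'
      rw [polar_comm] at this
      rw [QuadraticMap.map_add Q, this, hM.1 _ (hbM _), add_zero]
      generalize Q x = a
      revert a; decide
  have h1 : A.ncard + (perp Q M : Set V).ncard = (perp Q S : Set V).ncard :=
    Set.ncard_sdiff_add_ncard_of_subset hle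
  have h2 : {v ∈ (perp Q S : Set V) | Q v = 0} = {v ∈ A | Q v = 0} ∪ M := by
    ext v
    constructor
    · rintro ⟨hv, hv0⟩
      by_cases h : v ∈ perp Q M
      · exact Or.inr (mem_generator_of_mem_perp hQ hM h hv0)
      · exact Or.inl ⟨⟨hv, h⟩, hv0⟩
    · rintro (⟨⟨hv, -⟩, hv0⟩ | hv)
      · exact ⟨hv, hv0⟩
      · exact ⟨hle (hM.1.le_perp hv), hM.1 v hv⟩
  have h3 : Disjoint {v ∈ A | Q v = 0} (M : Set V) := by
    rw [Set.disjoint_left]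
    rintro v ⟨⟨-, h⟩, -⟩ hv
    exact h (hM.1.le_perp hv)
  have h4 := hM.1.finrank_add_finrank_perp hQ.nonsingular
  have h5 := hS.finrank_add_finrank_perp hQ.nonsingular
  rw [h2, Set.ncard_union_eq h3, ncard_submodule, hM.2.1]
  rw [ncard_submodule, ncard_submodule] at h1
  rw [hM.2.1] at h4
  rw [show finrank (ZMod 2) V - m = finrank (ZMod 2) (perp Q M) by omega,
    show finrank (ZMod 2) V - finrank (ZMod 2) S = finrank (ZMod 2) (perp Q S) by omega]
  omega

lemma HasWittIndex.two_mul_le (hQ : HasWittIndex Q m) : 2 * m ≤ finrank (ZMod 2) V := by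
  obtain ⟨M, hM, hMm⟩ := hQ.exists_finrank_eq
  have h1 := hM.finrank_add_finrank_perp hQ.nonsingular
  have h2 := Submodule.finrank_mono hM.le_perp
  omega

/-- An anisotropic quadratic form over `𝔽₂` has dimension at most two: it takes the value `1` on all
non-zero vectors, so any two distinct non-zero vectors have polar product `1`, which is not
additive on three independent vectors. -/
lemma HasWittIndex.finrank_le_two_mul_add_two (hQ : HasWittIndex Q m) :
    finrank (ZMod 2) V ≤ 2 * m + 2 := by
  obtain ⟨M, hM⟩ := exists_generator hQ (S := ⊥) (by
    intro v hv; rw [(Submodule.mem_bot _).1 hv, QuadraticMap.map_zero])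
  have h1 := hM.1.finrank_add_finrank_perp hQ.nonsingular
  rw [hM.2.1] at h1
  by_contra! hlt
  have hone : ∀ v ∈ perp Q M, v ∉ M → Q v = 1 := fun v hv hvM =>
    zmod_two_ne_zero_iff.1 fun h => hvM (mem_generator_of_mem_perp hQ hM hv h)
  have hpol : ∀ u ∈ perp Q M, ∀ v ∈ perp Q M, u ∉ M → v ∉ M → u + v ∉ M → polar Q u v = 1 := by
    intro u hu v hv hu' hv' huv
    rw [polar, hone _ (add_mem hu hv) huv, hone u hu hu', hone v hv hv']
    decide
  have hnew : ∀ W : Submodule (ZMod 2) V, finrank (ZMod 2) W < finrank (ZMod 2) (perp Q M) →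
      ∃ v ∈ perp Q M, v ∉ W := by
    intro W hW
    by_contra! h
    exact absurd (Submodule.finrank_mono (show perp Q M ≤ W from h)) (by omega)
  have hm := hM.2.1
  obtain ⟨u, hu, huM⟩ := hnew M (by omega)
  obtain ⟨v, hv, hvM⟩ := hnew (M ⊔ Submodule.span (ZMod 2) {u})
    (by rw [finrank_sup_span_singleton huM]; omega)
  obtain ⟨w, hw, hwM⟩ := hnew (M ⊔ Submodule.span (ZMod 2) {u} ⊔ Submodule.span (ZMod 2) {v})
    (by rw [finrank_sup_span_singleton hvM, finrank_sup_span_singleton huM]; omega)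
  simp only [mem_sup_span_singleton_zmod_two, not_or] at hvM hwM
  obtain ⟨hv1, hv2⟩ := hvM
  obtain ⟨⟨hw1, hw2⟩, hw3, hw4⟩ := hwM
  have e1 := hpol u hu v hv huM hv1 (by rwa [add_comm])
  have e2 := hpol u hu w hw huM hw1 (by rwa [add_comm])
  have e3 := hpol u hu (w + v) (add_mem hw hv) huM hw3 (by rwa [add_comm])
  rw [polar_add_right, e1, e2] at e3
  exact absurd e3 (by decide)

end

/-! ### Counting generators -/

/-- Double counting, for sets. -/
lemma ncard_mul_eq_ncard_mul {A B : Type*} {s : Set A} {t : Set B} (hs : s.Finite) (ht : t.Finite)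
    (r : A → B → Prop) {p q : ℕ} (hp : ∀ x ∈ s, {y ∈ t | r x y}.ncard = p)
    (hq : ∀ y ∈ t, {x ∈ s | r x y}.ncard = q) : s.ncard * p = t.ncard * q := by
  classical
  lift s to Finset A using hs
  lift t to Finset B using ht
  rw [Set.ncard_coe_finset, Set.ncard_coe_finset]
  refine Finset.card_mul_eq_card_mul r (fun x hx => ?_) (fun y hy => ?_)
  · rw [← hp x hx, ← Set.ncard_coe_finset]
    congr 1
    ext y; simp [Finset.bipartiteAbove]
  · rw [← hq y hy, ← Set.ncard_coe_finset]
    congr 1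
    ext x; simp [Finset.bipartiteBelow]

section

variable {V : Type*} [AddCommGroup V] [Module (ZMod 2) V] [Finite V]
  {Q : QuadraticForm (ZMod 2) V} {m e : ℕ}

/-- The number of generators through a totally singular subspace `S`, by induction on the
codimension `k` of `S` in a generator: the pairs of a singular vector `v` of `S^⊥` outside `S` and a
generator through `S` and `v` are counted in two ways. -/
lemma ncard_generators (hQ : HasWittIndex Q m) (hn : finrank (ZMod 2) V = 2 * m + e) {k : ℕ}
    {S : Submodule (ZMod 2) V} (hS : Contained Q S) (hk : finrank (ZMod 2) S + k = m) :
    (generators Q m S).ncard = ∏ i ∈ Finset.range k, (2 ^ (e + i) + 1) := by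
  induction k generalizing S with
  | zero =>
    have : generators Q m S = {S} := by
      ext M
      constructor
      · rintro ⟨-, h2, h3⟩
        exact (Submodule.eq_of_le_of_finrank_eq h3 (by omega)).symm
      · rintro rfl
        exact ⟨hS, by omega, le_rfl⟩
    simp [this]
  | succ k ih =>
    set s : Set V := {v ∈ (perp Q S : Set V) | Q v = 0} \ S with hs
    have hsub : (S : Set V) ⊆ {v ∈ (perp Q S : Set V) | Q v = 0} :=
      fun v hv => ⟨hS.le_perp hv, hS v hv⟩
    have h1 : s.ncard + (S : Set V).ncard = {v ∈ (perp Q S : Set V) | Q v = 0}.ncard :=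
      Set.ncard_sdiff_add_ncard_of_subset hsub
    have h2 := two_mul_ncard_singular_perp hQ hS
    rw [← h1, ncard_submodule] at h2
    have hcount := ncard_mul_eq_ncard_mul s.toFinite (generators Q m S).toFinite
      (fun v M => v ∈ M) (p := ∏ i ∈ Finset.range k, (2 ^ (e + i) + 1))
      (q := 2 ^ m - 2 ^ finrank (ZMod 2) S) ?_ ?_
    · set d := finrank (ZMod 2) S
      have hscard : s.ncard = (2 ^ m - 2 ^ d) * (2 ^ (e + k) + 1) := by
        have hle : 2 ^ d ≤ 2 ^ m := Nat.pow_le_pow_right (by norm_num) (by omega)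
        zify [hle]
        zify at h2
        rw [hn, show 2 * m + e - m = e + k + d + 1 by omega,
          show 2 * m + e - d = e + k + m + 1 by omega] at h2
        simp only [pow_add, pow_one] at h2 ⊢
        linarith
      rw [hscard] at hcount
      have hpos : 0 < 2 ^ m - 2 ^ d :=
        Nat.sub_pos_of_lt (Nat.pow_lt_pow_right (by norm_num) (by omega))
      rw [Finset.prod_range_succ]
      apply Nat.eq_of_mul_eq_mul_right hpos
      rw [← hcount]
      ring
    · rintro v ⟨⟨hv, hv0⟩, hvS⟩
      rw [← ih (hS.sup_span_singleton hv hv0) (by rw [finrank_sup_span_singleton hvS]; omega)]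
      congr 1
      ext M
      constructor
      · rintro ⟨⟨hM1, hM2, hM3⟩, hvM⟩
        exact ⟨hM1, hM2, sup_le hM3 ((Submodule.span_singleton_le_iff_mem _ _).2 hvM)⟩
      · rintro ⟨hM1, hM2, hM3⟩
        exact ⟨⟨hM1, hM2, le_sup_left.trans hM3⟩,
          hM3 (Submodule.mem_sup_right (Submodule.mem_span_singleton_self v))⟩
    · rintro M ⟨hM1, hM2, hM3⟩
      have h3 : {v ∈ s | v ∈ M} = (M : Set V) \ S := by
        ext v
        constructor
        · rintro ⟨⟨-, h⟩, h'⟩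
          exact ⟨h', h⟩
        · rintro ⟨h', h⟩
          exact ⟨⟨⟨perp_anti hM3 (hM1.le_perp h'), hM1 v h'⟩, h⟩, h'⟩
      have h4 := Set.ncard_sdiff_add_ncard_of_subset (s := (S : Set V)) (t := M) hM3
      rw [ncard_submodule, ncard_submodule, hM2] at h4
      rw [h3]
      omega

/-! ### Cliques of singular vectors -/

/-- `D` is a clique of the graph on the non-zero singular vectors of `Q` in which distinct vectors
are adjacent when `R` relates them. Over `𝔽₂` non-zero singular vectors stand for the points of the
quadric. -/
def IsVectorClique (Q : QuadraticForm (ZMod 2) V) (R : V → V → Prop) (D : Set V) : Prop :=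
  (∀ v ∈ D, v ≠ 0 ∧ Q v = 0) ∧ D.Pairwise R

/-- The adjacency of the point-graph in terms of vectors. -/
def orthRel (Q : QuadraticForm (ZMod 2) V) (u v : V) : Prop :=
  polar Q u v = 0

omit [Finite V] in
lemma contained_bot : Contained Q (⊥ : Submodule (ZMod 2) V) := by
  intro v hv
  rw [(Submodule.mem_bot _).1 hv, QuadraticMap.map_zero]

omit [Finite V] in
lemma IsVectorClique.contained_span {D : Set V} (hD : IsVectorClique Q (orthRel Q) D) :
    Contained Q (Submodule.span (ZMod 2) D) := by
  refine QuadricGraph.contained_span (fun v hv => (hD.1 v hv).2) fun v hv w hw => ?_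
  rcases eq_or_ne v w with rfl | h
  · exact polar_self_eq_zero v
  · exact hD.2 hv hw h

lemma IsVectorClique.exists_generator (hQ : HasWittIndex Q m) {D : Set V}
    (hD : IsVectorClique Q (orthRel Q) D) :
    ∃ M ∈ generators Q m ⊥, D ⊆ (M : Set V) \ {0} := by
  obtain ⟨M, h1, h2, h3⟩ := QuadricGraph.exists_generator hQ hD.contained_span
  exact ⟨M, ⟨h1, h2, bot_le⟩, fun v hv => ⟨h3 (Submodule.subset_span hv), (hD.1 v hv).1⟩⟩

omit [Finite V] in
lemma Contained.isVectorClique {M : Submodule (ZMod 2) V} (hM : Contained Q M) :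
    IsVectorClique Q (orthRel Q) ((M : Set V) \ {0}) :=
  ⟨fun v hv => ⟨hv.2, hM v hv.1⟩, fun _ hv _ hw _ => hM.polar_eq_zero hv.1 hw.1⟩

lemma ncard_submodule_sdiff_zero (M : Submodule (ZMod 2) V) :
    ((M : Set V) \ {0}).ncard = 2 ^ finrank (ZMod 2) M - 1 := by
  rw [Set.ncard_sdiff_singleton_of_mem (zero_mem M), ncard_submodule]

omit [Finite V] in
lemma submodule_sdiff_zero_injective :
    Function.Injective fun M : Submodule (ZMod 2) V => (M : Set V) \ {0} := by
  intro M N h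
  apply SetLike.coe_injective
  have := congrArg (fun s : Set V => insert 0 s) h
  simpa [Set.insert_eq_of_mem] using this

lemma IsVectorClique.ncard_le (hQ : HasWittIndex Q m) {D : Set V}
    (hD : IsVectorClique Q (orthRel Q) D) : D.ncard ≤ 2 ^ m - 1 := by
  obtain ⟨M, hM, h⟩ := hD.exists_generator hQ
  rw [← hM.2.1, ← ncard_submodule_sdiff_zero]
  exact Set.ncard_le_ncard h

lemma IsVectorClique.exists_eq (hQ : HasWittIndex Q m) {D : Set V}
    (hD : IsVectorClique Q (orthRel Q) D) (h : D.ncard = 2 ^ m - 1) :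
    ∃ M ∈ generators Q m ⊥, D = (M : Set V) \ {0} := by
  obtain ⟨M, hM, hDM⟩ := hD.exists_generator hQ
  refine ⟨M, hM, Set.eq_of_subset_of_ncard_le hDM ?_⟩
  rw [ncard_submodule_sdiff_zero, hM.2.1, h]

lemma setOf_isVectorClique_orthRel (hQ : HasWittIndex Q m) :
    {D : Set V | IsVectorClique Q (orthRel Q) D ∧ D.ncard = 2 ^ m - 1} =
      (fun M : Submodule (ZMod 2) V => (M : Set V) \ {0}) '' generators Q m ⊥ := by
  ext D
  constructor
  · rintro ⟨hD, h⟩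
    obtain ⟨M, hM, rfl⟩ := hD.exists_eq hQ h
    exact ⟨M, hM, rfl⟩
  · rintro ⟨M, hM, rfl⟩
    exact ⟨hM.1.isVectorClique, by simp only [ncard_submodule_sdiff_zero, hM.2.1]⟩

lemma setOf_maximal_isVectorClique_orthRel (hQ : HasWittIndex Q m) :
    {D : Set V | Maximal (IsVectorClique Q (orthRel Q)) D} =
      (fun M : Submodule (ZMod 2) V => (M : Set V) \ {0}) '' generators Q m ⊥ := by
  ext D
  constructor
  · intro hD
    obtain ⟨M, hM, h⟩ := hD.1.exists_generator hQ
    exact ⟨M, hM, (hD.eq_of_subset hM.1.isVectorClique h).symm⟩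
  · rintro ⟨M, hM, rfl⟩
    refine ⟨hM.1.isVectorClique, fun D hD h => ?_⟩
    have h1 := hD.ncard_le hQ
    rw [← hM.2.1, ← ncard_submodule_sdiff_zero] at h1
    exact (Set.eq_of_subset_of_ncard_le h h1).symm.subset

lemma ncard_generators_bot (hQ : HasWittIndex Q m) (hn : finrank (ZMod 2) V = 2 * m + e) :
    (generators Q m (⊥ : Submodule (ZMod 2) V)).ncard =
      ∏ i ∈ Finset.range m, (2 ^ (e + i) + 1) :=
  ncard_generators hQ hn contained_bot (by simp)

/-! ### Cliques after switching -/

/-- The adjacency of the switched graph in terms of vectors: orthogonality is complemented between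
the vectors of `α^⊥` outside `α` and the vectors outside `α^⊥`. -/
def switchedRel (Q : QuadraticForm (ZMod 2) V) (α : Submodule (ZMod 2) V) (u v : V) : Prop :=
  Xor (polar Q u v = 0)
    ((u ∈ perp Q α ∧ u ∉ α ∧ v ∉ perp Q α) ∨ (v ∈ perp Q α ∧ v ∉ α ∧ u ∉ perp Q α))

/-- The clique of the switched graph attached to a generator `T ⊇ α` and a singular vector
`y ∉ α^⊥`. With `H = T ∩ y^⊥`, it consists of the vectors of `T` outside `H ∪ α`, the non-zero
vectors of `H ∩ α`, and the coset `y + H`. -/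
def switchedClique (Q : QuadraticForm (ZMod 2) V) (α T : Submodule (ZMod 2) V) (y : V) : Set V :=
  {t | t ∈ T ∧ t ∉ α ∧ polar Q t y = 1} ∪ {t | (t ∈ α ∧ polar Q t y = 0) ∧ t ≠ 0} ∪
    {v | v + y ∈ T ∧ polar Q v y = 0}

variable {α T : Submodule (ZMod 2) V} {y : V}

omit [Finite V] in
lemma switchedRel_symm {u v : V} (h : switchedRel Q α u v) : switchedRel Q α v u := by
  unfold switchedRel at h ⊢
  rwa [polar_comm, or_comm]

omit [Finite V] in
lemma switchedRel_iff_polar_eq_one {u v : V} (hu : u ∈ perp Q α) (hu' : u ∉ α)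
    (hv : v ∉ perp Q α) : switchedRel Q α u v ↔ polar Q u v = 1 := by
  unfold switchedRel Xor
  rw [← zmod_two_ne_zero_iff]
  tauto

omit [Finite V] in
lemma switchedRel_iff_of_mem_perp {u v : V} (hu : u ∈ perp Q α) (hv : v ∈ perp Q α) :
    switchedRel Q α u v ↔ polar Q u v = 0 := by
  unfold switchedRel Xor
  tauto

omit [Finite V] in
lemma switchedRel_iff_of_notMem_perp {u v : V} (hu : u ∉ perp Q α) (hv : v ∉ perp Q α) :
    switchedRel Q α u v ↔ polar Q u v = 0 := by
  unfold switchedRel Xor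
  tauto

omit [Finite V] in
lemma switchedRel_iff_of_mem (hα : Contained Q α) {u v : V} (hu : u ∈ α) :
    switchedRel Q α u v ↔ polar Q u v = 0 := by
  have := hα.le_perp hu
  unfold switchedRel Xor
  tauto

/-- The linear functional `polar Q · y` takes the value `1` exactly half of the time on a
finite set that is invariant under translation by some `b` with `polar Q b y = 1`. -/
lemma two_mul_ncard_polar_eq_one {A : Set V} {b : V} (hb : polar Q b y = 1)
    (hA : ∀ x ∈ A, x + b ∈ A) : 2 * {x ∈ A | polar Q x y = 1}.ncard = A.ncard := by
  refine two_mul_ncard_sep_of_involution A.toFinite (· + b) hA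
    (fun x _ => add_add_cancel_of_zmod_two x b) fun x _ => ?_
  rw [polar_add_left, hb]
  generalize polar Q x y = c
  revert c; decide

lemma two_mul_ncard_polar_eq_zero {A : Set V} {b : V} (hb : polar Q b y = 1)
    (hA : ∀ x ∈ A, x + b ∈ A) : 2 * {x ∈ A | polar Q x y = 0}.ncard = A.ncard := by
  refine two_mul_ncard_sep_of_involution A.toFinite (· + b) hA
    (fun x _ => add_add_cancel_of_zmod_two x b) fun x _ => ?_
  rw [polar_add_left, hb]
  generalize polar Q x y = c
  revert c; decide

lemma ncard_sdiff_polar_eq_one (hαT : α ≤ T) (hy : y ∉ perp Q α) :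
    2 * {t | t ∈ T ∧ t ∉ α ∧ polar Q t y = 1}.ncard =
      2 ^ finrank (ZMod 2) T - 2 ^ finrank (ZMod 2) α := by
  obtain ⟨b, hbα, hb⟩ := exists_polar_eq_one hy
  have h1 := two_mul_ncard_polar_eq_one (A := (T : Set V) \ α) hb (by
    rintro x ⟨hx, hx'⟩
    refine ⟨add_mem hx (hαT hbα), fun h => hx' ?_⟩
    simpa using sub_mem h hbα)
  have h2 := Set.ncard_sdiff_add_ncard_of_subset (s := (α : Set V)) (t := T) hαT
  rw [ncard_submodule, ncard_submodule] at h2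
  rw [show {t | t ∈ T ∧ t ∉ α ∧ polar Q t y = 1} = {x ∈ (T : Set V) \ α | polar Q x y = 1} by
    ext; simp [and_assoc], h1]
  omega

lemma ncard_polar_eq_zero (T : Submodule (ZMod 2) V) {b : V} (hbT : b ∈ T)
    (hb : polar Q b y = 1) :
    2 * {t | t ∈ T ∧ polar Q t y = 0}.ncard = 2 ^ finrank (ZMod 2) T := by
  rw [← ncard_submodule, ← two_mul_ncard_polar_eq_zero (A := (T : Set V)) hb
    fun x hx => add_mem hx hbT]
  rfl

lemma ncard_polar_eq_zero_ne_zero (hy : y ∉ perp Q α) :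
    2 * {t | (t ∈ α ∧ polar Q t y = 0) ∧ t ≠ 0}.ncard + 2 = 2 ^ finrank (ZMod 2) α := by
  obtain ⟨b, hbα, hb⟩ := exists_polar_eq_one hy
  rw [← ncard_polar_eq_zero α hbα hb,
    ← Set.ncard_sdiff_singleton_add_one (s := {t | t ∈ α ∧ polar Q t y = 0}) (a := 0)
      ⟨zero_mem _, polar_zero_left _ _⟩]
  rw [mul_add, mul_one]
  rfl

omit [Finite V] in
lemma ncard_translate_polar_eq_zero (T : Submodule (ZMod 2) V) (y : V) :
    {v | v + y ∈ T ∧ polar Q v y = 0}.ncard = {t | t ∈ T ∧ polar Q t y = 0}.ncard := by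
  refine Set.ncard_congr (fun v _ => v + y) ?_ ?_ ?_
  · rintro v ⟨h1, h2⟩
    exact ⟨h1, by rw [polar_add_left, h2, polar_self_eq_zero, add_zero]⟩
  · intro v w _ _ h
    exact add_right_cancel h
  · rintro t ⟨h1, h2⟩
    refine ⟨t + y, ⟨?_, ?_⟩, add_add_cancel_of_zmod_two t y⟩
    · rwa [add_add_cancel_of_zmod_two]
    · rw [polar_add_left, h2, polar_self_eq_zero, add_zero]

omit [Finite V] in
lemma notMem_perp_of_mem_coset (hT : Contained Q T) (hαT : α ≤ T)
    (hy : y ∉ perp Q α) {v : V} (hv : v + y ∈ T) : v ∉ perp Q α := by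
  intro h
  apply hy
  have h1 := sub_mem (perp_anti hαT (hT.le_perp hv)) h
  simpa using h1

lemma ncard_switchedClique (hT : T ∈ generators Q m α)
    (hy : y ∉ perp Q α) : (switchedClique Q α T y).ncard = 2 ^ m - 1 := by
  obtain ⟨b, hbα, hb⟩ := exists_polar_eq_one hy
  have h1 := ncard_sdiff_polar_eq_one hT.2.2 hy
  have h2 := ncard_polar_eq_zero_ne_zero hy
  have h3 := ncard_polar_eq_zero T (hT.2.2 hbα) hb
  rw [← ncard_translate_polar_eq_zero] at h3
  have h4 : 2 ^ finrank (ZMod 2) α ≤ 2 ^ finrank (ZMod 2) T :=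
    Nat.pow_le_pow_right (by norm_num) (Submodule.finrank_mono hT.2.2)
  have h5 : Disjoint {t | t ∈ T ∧ t ∉ α ∧ polar Q t y = 1}
      {t | (t ∈ α ∧ polar Q t y = 0) ∧ t ≠ 0} := by
    rw [Set.disjoint_left]
    rintro t ⟨-, h, -⟩ ⟨⟨h', -⟩, -⟩
    exact h h'
  have h6 : Disjoint ({t | t ∈ T ∧ t ∉ α ∧ polar Q t y = 1} ∪
      {t | (t ∈ α ∧ polar Q t y = 0) ∧ t ≠ 0}) {v | v + y ∈ T ∧ polar Q v y = 0} := by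
    rw [Set.disjoint_left]
    rintro t h ⟨h', -⟩
    refine notMem_perp_of_mem_coset hT.1 hT.2.2 hy h' (perp_anti hT.2.2 (hT.1.le_perp ?_))
    rcases h with ⟨h, -⟩ | ⟨⟨h, -⟩, -⟩
    · exact h
    · exact hT.2.2 h
  unfold switchedClique
  rw [Set.ncard_union_eq h6, Set.ncard_union_eq h5]
  rw [hT.2.1] at h1 h3 h4
  omega

omit [Finite V] in
lemma isVectorClique_switchedClique (hα : Contained Q α) (hT : T ∈ generators Q m α)
    (hy0 : Q y = 0) (hy : y ∉ perp Q α) :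
    IsVectorClique Q (switchedRel Q α) (switchedClique Q α T y) := by
  have hTperp : T ≤ perp Q α := hT.1.le_perp.trans (perp_anti hT.2.2)
  have hval : ∀ {t v}, t ∈ T → v + y ∈ T → polar Q t v = polar Q t y := by
    intro t v ht hv
    have := hT.1.polar_eq_zero ht hv
    rw [polar_add_right] at this
    exact CharTwo.add_eq_zero.1 this
  have hcoset : ∀ {v w}, v + y ∈ T → polar Q v y = 0 → w + y ∈ T → polar Q w y = 0 →
      polar Q v w = 0 := by
    intro v w hv hv' hw hw'
    have := hT.1.polar_eq_zero hv hw
    rw [polar_add_left, polar_add_right, polar_add_right, polar_self_eq_zero, polar_comm Q y w,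
      hv', hw'] at this
    simpa using this
  refine ⟨?_, ?_⟩
  · rintro v ((⟨h1, h2, h3⟩ | ⟨⟨h1, h2⟩, h3⟩) | ⟨h1, h2⟩)
    · exact ⟨fun h => h2 (h ▸ zero_mem α), hT.1 v h1⟩
    · exact ⟨h3, hα v h1⟩
    · refine ⟨fun h => notMem_perp_of_mem_coset hT.1 hT.2.2 hy h1 (h ▸ zero_mem _), ?_⟩
      have := hT.1 _ h1
      rwa [map_add_of_polar_eq_zero h2, hy0, add_zero] at this
  · rintro u ((⟨h1, h2, h3⟩ | ⟨⟨h1, h2⟩, h3⟩) | ⟨h1, h2⟩) v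
      ((⟨h4, h5, h6⟩ | ⟨⟨h4, h5⟩, h6⟩) | ⟨h4, h5⟩) -
    · exact (switchedRel_iff_of_mem_perp (hTperp h1) (hTperp h4)).2 (hT.1.polar_eq_zero h1 h4)
    · exact (switchedRel_iff_of_mem_perp (hTperp h1) (hα.le_perp h4)).2
        (hT.1.polar_eq_zero h1 (hT.2.2 h4))
    · exact (switchedRel_iff_polar_eq_one (hTperp h1) h2
        (notMem_perp_of_mem_coset hT.1 hT.2.2 hy h4)).2 ((hval h1 h4).trans h3)
    · exact (switchedRel_iff_of_mem hα h1).2 (hT.1.polar_eq_zero (hT.2.2 h1) h4)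
    · exact (switchedRel_iff_of_mem hα h1).2 (hα.polar_eq_zero h1 h4)
    · exact (switchedRel_iff_of_mem hα h1).2 ((hval (hT.2.2 h1) h4).trans h2)
    · exact switchedRel_symm ((switchedRel_iff_polar_eq_one (hTperp h4) h5
        (notMem_perp_of_mem_coset hT.1 hT.2.2 hy h1)).2 ((hval h4 h1).trans h6))
    · exact switchedRel_symm ((switchedRel_iff_of_mem hα h4).2
        ((hval (hT.2.2 h4) h1).trans h5))
    · exact (switchedRel_iff_of_notMem_perp (notMem_perp_of_mem_coset hT.1 hT.2.2 hy h1)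
        (notMem_perp_of_mem_coset hT.1 hT.2.2 hy h4)).2 (hcoset h1 h2 h4 h5)

end

section

variable {V : Type*} [AddCommGroup V] [Module (ZMod 2) V] [Finite V]
  {Q : QuadraticForm (ZMod 2) V} {m e : ℕ} {α T : Submodule (ZMod 2) V} {y : V}

omit [Finite V] in
/-- If the switched relation never relates two vectors of `D` in the complemented way, then `D` is
also a clique of the point-graph. -/
lemma IsVectorClique.orthRel_of_forall {D : Set V}
    (hD : IsVectorClique Q (switchedRel Q α) D)
    (h : (∀ v ∈ D, v ∈ perp Q α) ∨ ∀ v ∈ D, v ∈ perp Q α → v ∈ α) :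
    IsVectorClique Q (orthRel Q) D := by
  refine ⟨hD.1, fun u hu v hv huv => ?_⟩
  have h1 : Xor _ _ := hD.2 hu hv huv
  rcases h with h | h
  · have := h u hu; have := h v hv
    unfold Xor at h1; unfold orthRel; tauto
  · have := h u hu; have := h v hv
    unfold Xor at h1; unfold orthRel; tauto

/-- The part of a switched clique outside `α^⊥`, being totally isotropic and contained in an affine
hyperplane off the origin, has at most half the size of a generator. -/
lemma two_mul_ncard_le_of_polar_eq_one (hQ : HasWittIndex Q m) {D : Set V} {x : V}
    (h0 : ∀ v ∈ D, Q v = 0) (h : ∀ v ∈ D, ∀ w ∈ D, polar Q v w = 0)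
    (hx : ∀ v ∈ D, polar Q v x = 1) : 2 * D.ncard ≤ 2 ^ m := by
  rcases D.eq_empty_or_nonempty with rfl | ⟨b, hb⟩
  · simp
  have hU := contained_span h0 h
  have hbU := Submodule.subset_span (R := ZMod 2) hb
  have h1 := two_mul_ncard_polar_eq_one (A := (Submodule.span (ZMod 2) D : Set V)) (hx b hb)
    fun v hv => add_mem hv hbU
  rw [ncard_submodule] at h1
  have h2 : D.ncard ≤ {v ∈ (Submodule.span (ZMod 2) D : Set V) | polar Q v x = 1}.ncard :=
    Set.ncard_le_ncard fun v hv => ⟨Submodule.subset_span hv, hx v hv⟩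
  have h3 : 2 ^ finrank (ZMod 2) (Submodule.span (ZMod 2) D) ≤ 2 ^ m :=
    Nat.pow_le_pow_right (by norm_num) (hQ.finrank_le _ hU)
  omega

/-- A clique of the switched graph that meets both `α^⊥ \ α` and the complement of `α^⊥` is at most
as large as the point set of a generator, and the cliques attaining this bound are those of the form
`switchedClique Q α T y`. The bound comes from adding the sizes of the three parts of the clique;
in the case of equality each part is as large as possible, so every `y` of the clique outside
`α^⊥` induces the same functional on a generator `T ⊇ α`. -/
lemma IsVectorClique.mixed (hQ : HasWittIndex Q m) (hα : Contained Q α) {D : Set V}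
    (hD : IsVectorClique Q (switchedRel Q α) D) {x : V} (hxD : x ∈ D) (hx : x ∈ perp Q α)
    (hxα : x ∉ α) (hyD : y ∈ D) (hy : y ∉ perp Q α) :
    D.ncard ≤ 2 ^ m - 1 ∧ (D.ncard = 2 ^ m - 1 →
      ∃ T ∈ generators Q m α, D = switchedClique Q α T y) := by
  have hperp : ∀ u ∈ D, ∀ v ∈ D, u ∈ perp Q α → v ∈ perp Q α → polar Q u v = 0 := by
    intro u hu v hv hu' hv'
    rcases eq_or_ne u v with rfl | huv
    · exact polar_self_eq_zero u
    · exact (switchedRel_iff_of_mem_perp hu' hv').1 (hD.2 hu hv huv)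
  have hout : ∀ u ∈ D, ∀ v ∈ D, u ∉ perp Q α → v ∉ perp Q α → polar Q u v = 0 := by
    intro u hu v hv hu' hv'
    rcases eq_or_ne u v with rfl | huv
    · exact polar_self_eq_zero u
    · exact (switchedRel_iff_of_notMem_perp hu' hv').1 (hD.2 hu hv huv)
  have hmix : ∀ u ∈ D, ∀ v ∈ D, u ∈ perp Q α → u ∉ α → v ∉ perp Q α → polar Q u v = 1 := by
    intro u hu v hv hu' hu'' hv'
    exact (switchedRel_iff_polar_eq_one hu' hu'' hv').1
      (hD.2 hu hv fun h => hv' (h ▸ hu'))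
  have hin : ∀ u ∈ D, ∀ v ∈ D, u ∈ α → v ∉ perp Q α → polar Q u v = 0 := by
    intro u hu v hv hu' hv'
    exact (switchedRel_iff_of_mem hα hu').1
      (hD.2 hu hv fun h => hv' (h ▸ hα.le_perp hu'))
  set X : Set V := {v ∈ D | v ∈ perp Q α ∧ v ∉ α} with hX
  set Y : Set V := {v ∈ D | v ∉ perp Q α} with hY
  set A : Set V := {v ∈ D | v ∈ α} with hA
  obtain ⟨T, hT1, hT2, hT3⟩ : ∃ T, T ∈ generators Q m (Submodule.span (ZMod 2) (X ∪ α)) := by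
    refine QuadricGraph.exists_generator hQ (QuadricGraph.contained_span ?_ ?_)
    · rintro v (hv | hv)
      · exact (hD.1 v hv.1).2
      · exact hα v hv
    · rintro v (hv | hv) w (hw | hw)
      · exact hperp v hv.1 w hw.1 hv.2.1 hw.2.1
      · rw [polar_comm]
        exact hv.2.1 w hw
      · exact hw.2.1 v hv
      · exact hα.polar_eq_zero hv hw
  have hXT : ∀ v ∈ X, v ∈ T := fun v hv => hT3 (Submodule.subset_span (Or.inl hv))
  have hαT : α ≤ T := fun v hv => hT3 (Submodule.subset_span (Or.inr hv))
  have hT : T ∈ generators Q m α := ⟨hT1, hT2, hαT⟩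
  have hXsub : ∀ z ∈ Y, X ⊆ {t | t ∈ T ∧ t ∉ α ∧ polar Q t z = 1} := fun z hz v hv =>
    ⟨hXT v hv, hv.2.2, hmix v hv.1 z hz.1 hv.2.1 hv.2.2 hz.2⟩
  have hAsub : ∀ z ∈ Y, A ⊆ {t | (t ∈ α ∧ polar Q t z = 0) ∧ t ≠ 0} := fun z hz v hv =>
    ⟨⟨hv.2, hin v hv.1 z hz.1 hv.2 hz.2⟩, (hD.1 v hv.1).1⟩
  have hYcard : 2 * Y.ncard ≤ 2 ^ m := two_mul_ncard_le_of_polar_eq_one hQ (x := x)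
    (fun v hv => (hD.1 v hv.1).2) (fun v hv w hw => hout v hv.1 w hw.1 hv.2 hw.2)
    (fun v hv => by rw [polar_comm]; exact hmix x hxD v hv.1 hx hxα hv.2)
  have hDeq : D = X ∪ A ∪ Y := by
    ext v
    simp only [hX, hY, hA, Set.mem_union, Set.mem_ofPred_eq]
    have : v ∈ α → v ∈ perp Q α := fun h => hα.le_perp h
    tauto
  have hDcard : D.ncard ≤ X.ncard + A.ncard + Y.ncard := by
    conv_lhs => rw [hDeq]
    exact (Set.ncard_union_le _ _).trans (Nat.add_le_add_right (Set.ncard_union_le _ _) _)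
  have hle : 2 ^ finrank (ZMod 2) α ≤ 2 ^ m :=
    Nat.pow_le_pow_right (by norm_num) (hQ.finrank_le α hα)
  have hXfull := fun z (hz : z ∈ Y) => ncard_sdiff_polar_eq_one (Q := Q) hαT hz.2
  have hAfull := fun z (hz : z ∈ Y) => ncard_polar_eq_zero_ne_zero (Q := Q) hz.2
  rw [hT2] at hXfull
  have hXle := fun z (hz : z ∈ Y) => Set.ncard_le_ncard (hXsub z hz)
  have hAle := fun z (hz : z ∈ Y) => Set.ncard_le_ncard (hAsub z hz)
  have hyY : y ∈ Y := ⟨hyD, hy⟩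
  refine ⟨?_, fun hcard => ⟨T, hT, ?_⟩⟩
  · have h1 := hXfull y hyY; have h2 := hAfull y hyY
    have h3 := hXle y hyY; have h4 := hAle y hyY
    omega
  have hXeq : ∀ z ∈ Y, X = {t | t ∈ T ∧ t ∉ α ∧ polar Q t z = 1} := by
    intro z hz
    refine Set.eq_of_subset_of_ncard_le (hXsub z hz) ?_
    have h1 := hXfull z hz; have h2 := hAfull z hz
    have h3 := hXle z hz; have h4 := hAle z hz
    omega
  have hAeq : ∀ z ∈ Y, A = {t | (t ∈ α ∧ polar Q t z = 0) ∧ t ≠ 0} := by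
    intro z hz
    refine Set.eq_of_subset_of_ncard_le (hAsub z hz) ?_
    have h1 := hXfull z hz; have h2 := hAfull z hz
    have h3 := hXle z hz; have h4 := hAle z hz
    omega
  -- the functionals of two vectors of `Y` agree on `α`, and then on all of `T`
  have hfunα : ∀ z ∈ Y, ∀ t ∈ α, polar Q t y = 0 → polar Q t z = 0 := by
    intro z hz t ht h
    rcases eq_or_ne t 0 with rfl | ht0
    · exact polar_zero_left _ _
    have h1 : t ∈ A := by rw [hAeq y hyY]; exact ⟨⟨ht, h⟩, ht0⟩
    rw [hAeq z hz] at h1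
    exact h1.1.2
  have hfunα' : ∀ z ∈ Y, ∀ t ∈ α, polar Q t z = 0 → polar Q t y = 0 := by
    intro z hz t ht h
    rcases eq_or_ne t 0 with rfl | ht0
    · exact polar_zero_left _ _
    have h1 : t ∈ A := by rw [hAeq z hz]; exact ⟨⟨ht, h⟩, ht0⟩
    rw [hAeq y hyY] at h1
    exact h1.1.2
  obtain ⟨b, hbα, hb⟩ := exists_polar_eq_one hy
  have hfun : ∀ z ∈ Y, ∀ t ∈ T, polar Q t (z + y) = 0 := by
    intro z hz t ht
    have hbz : polar Q b z = 1 := by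
      rw [← zmod_two_ne_zero_iff] at hb ⊢
      exact fun h => hb (hfunα' z hz b hbα h)
    have hiff : polar Q t y = 1 ↔ polar Q t z = 1 := by
      by_cases htα : t ∈ α
      · rw [← zmod_two_ne_zero_iff, ← zmod_two_ne_zero_iff, not_iff_not]
        exact ⟨hfunα z hz t htα, hfunα' z hz t htα⟩
      · have h1 : t ∈ {t | t ∈ T ∧ t ∉ α ∧ polar Q t y = 1} ↔
            t ∈ {t | t ∈ T ∧ t ∉ α ∧ polar Q t z = 1} := by rw [← hXeq y hyY, ← hXeq z hz]
        simpa [ht, htα] using h1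
    rw [polar_add_right]
    generalize polar Q t y = c at hiff ⊢
    generalize polar Q t z = d at hiff ⊢
    revert c d; decide
  refine Set.eq_of_subset_of_ncard_le ?_ (by rw [ncard_switchedClique hT hy, hcard])
  rw [hDeq]
  unfold switchedClique
  refine Set.union_subset_union (Set.union_subset_union (hXsub y hyY) (hAsub y hyY)) ?_
  intro z hz
  have hzy : polar Q z y = 0 := hout z hz.1 y hyD hz.2 hy
  refine ⟨mem_generator_of_mem_perp hQ hT (fun t ht => hfun z hz t ht) ?_, hzy⟩
  rw [map_add_of_polar_eq_zero hzy, (hD.1 z hz.1).2, (hD.1 y hyD).2, add_zero]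

/-- The cliques of the switched graph have at most as many elements as those of the point-graph,
and those of this size are the point sets of generators through `α` together with the cliques
`switchedClique Q α T y`. -/
lemma IsVectorClique.switched (hQ : HasWittIndex Q m) (hα : Contained Q α)
    (hαm : finrank (ZMod 2) α < m) {D : Set V} (hD : IsVectorClique Q (switchedRel Q α) D) :
    D.ncard ≤ 2 ^ m - 1 ∧ (D.ncard = 2 ^ m - 1 →
      (∃ M ∈ generators Q m α, D = (M : Set V) \ {0}) ∨
      ∃ T ∈ generators Q m α, ∃ y, (Q y = 0 ∧ y ∉ perp Q α) ∧ D = switchedClique Q α T y) := by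
  by_cases hY : ∀ v ∈ D, v ∈ perp Q α
  · have hD' := hD.orthRel_of_forall (Or.inl hY)
    refine ⟨hD'.ncard_le hQ, fun h => Or.inl ?_⟩
    obtain ⟨M, hM, rfl⟩ := hD'.exists_eq hQ h
    refine ⟨M, ⟨hM.1, hM.2.1, fun v hv => ?_⟩, rfl⟩
    refine mem_generator_of_mem_perp hQ hM (fun w hw => ?_) (hα v hv)
    rcases eq_or_ne w 0 with rfl | hw0
    · exact polar_zero_left _ _
    · change polar Q w v = 0
      rw [polar_comm]
      exact hY w ⟨hw, hw0⟩ v hv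
  by_cases hX : ∀ v ∈ D, v ∈ perp Q α → v ∈ α
  · have hD' := hD.orthRel_of_forall (Or.inr hX)
    refine ⟨hD'.ncard_le hQ, fun h => ?_⟩
    -- impossible: a generator contains a vector of `α^⊥` outside `α`
    obtain ⟨M, hM, rfl⟩ := hD'.exists_eq hQ h
    obtain ⟨v, hv, hv1, hv2⟩ := exists_mem_perp_notMem hQ.nonsingular hα hM.1 (by rw [hM.2.1]; omega)
    exact absurd (hX v ⟨hv, fun h => hv2 (h ▸ zero_mem α)⟩ hv1) hv2
  push Not at hX hY
  obtain ⟨x, hxD, hx, hxα⟩ := hX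
  obtain ⟨y, hyD, hy⟩ := hY
  obtain ⟨h1, h2⟩ := hD.mixed hQ hα hxD hx hxα hyD hy
  refine ⟨h1, fun h => Or.inr ?_⟩
  obtain ⟨T, hT, hDT⟩ := h2 h
  exact ⟨T, hT, y, ⟨(hD.1 y hyD).2, hy⟩, hDT⟩

omit [Finite V] in
lemma mem_switchedClique_self (T : Submodule (ZMod 2) V) (y : V) :
    y ∈ switchedClique Q α T y :=
  Or.inr ⟨by rw [add_self_eq_zero_of_zmod_two]; exact zero_mem T, polar_self_eq_zero y⟩

/-- Two pairs `(T, y)` and `(T', y')` give the same clique exactly when `T = T'` and `y`, `y'` lie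
in the same coset of `T ∩ y^⊥`. -/
lemma switchedClique_eq_iff {T T' : Submodule (ZMod 2) V} {y y' : V} (hα : Contained Q α)
    (hT : T ∈ generators Q m α) (hT' : T' ∈ generators Q m α) (hy : y ∉ perp Q α)
    (hy' : y' ∉ perp Q α) :
    switchedClique Q α T' y' = switchedClique Q α T y ↔
      T' = T ∧ y' ∈ {v | v + y ∈ T ∧ polar Q v y = 0} := by
  constructor
  · intro h
    have hmem : ∀ {T : Submodule (ZMod 2) V} {y v : V}, T ∈ generators Q m α → y ∉ perp Q α →
        v ∉ perp Q α → v ∈ switchedClique Q α T y → v + y ∈ T ∧ polar Q v y = 0 := by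
      rintro T y v hT hy hv ((⟨h1, -⟩ | ⟨⟨h1, -⟩, -⟩) | h1)
      · exact absurd (perp_anti hT.2.2 (hT.1.le_perp h1)) hv
      · exact absurd (hα.le_perp h1) hv
      · exact h1
    have hself := hmem hT hy hy' (h ▸ mem_switchedClique_self T' y')
    refine ⟨Eq.symm ?_, hself⟩
    obtain ⟨b, hbα, hb⟩ := exists_polar_eq_one hy
    have hTT' : ∀ t ∈ T, t ∉ α → polar Q t y = 1 → t ∈ T' := by
      intro t ht htα h1
      have h2 : t ∈ switchedClique Q α T' y' := by rw [h]; exact Or.inl (Or.inl ⟨ht, htα, h1⟩)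
      rcases h2 with (⟨h3, -⟩ | ⟨⟨h3, -⟩, -⟩) | ⟨h3, -⟩
      · exact h3
      · exact hT'.2.2 h3
      · exact absurd (perp_anti hT.2.2 (hT.1.le_perp ht))
          (notMem_perp_of_mem_coset hT'.1 hT'.2.2 hy' h3)
    refine Submodule.eq_of_le_of_finrank_eq (fun t ht => ?_) (hT.2.1.trans hT'.2.1.symm)
    by_cases htα : t ∈ α
    · exact hT'.2.2 htα
    by_cases h1 : polar Q t y = 1
    · exact hTT' t ht htα h1
    · rw [← zmod_two_ne_zero_iff, not_not] at h1
      have h2 : t + b ∈ T' := by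
        refine hTT' _ (add_mem ht (hT.2.2 hbα)) (fun h => htα ?_) ?_
        · simpa using sub_mem h hbα
        · rw [polar_add_left, h1, hb, zero_add]
      simpa using sub_mem h2 (hT'.2.2 hbα)
  · rintro ⟨rfl, h1, h2⟩
    have hval : ∀ t ∈ T', polar Q t y' = polar Q t y := by
      intro t ht
      have := hT.1.polar_eq_zero ht h1
      rw [polar_add_right] at this
      exact CharTwo.add_eq_zero.1 this
    have hcoset : ∀ v, v + y' ∈ T' ↔ v + y ∈ T' := by
      intro v
      have h3 : v + y' = v + y + (y' + y) := by
        rw [add_comm y' y, add_assoc, ← add_assoc y y, add_self_eq_zero_of_zmod_two, zero_add]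
      rw [h3]
      exact ⟨fun h => by simpa using sub_mem h h1, fun h => add_mem h h1⟩
    unfold switchedClique
    congr 1
    · congr 1
      · ext t
        simp only [Set.mem_ofPred_eq]
        exact and_congr_right fun ht => by rw [hval t ht]
      · ext t
        simp only [Set.mem_ofPred_eq]
        exact and_congr_left fun _ => and_congr_right fun ht => by rw [hval t (hT.2.2 ht)]
    · ext v
      simp only [Set.mem_ofPred_eq]
      rw [hcoset]
      refine and_congr_right fun hv => ?_
      have h3 := hval _ hv
      rw [polar_add_left, polar_add_left, polar_self_eq_zero, add_zero, polar_comm Q y y', h2,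
        add_zero] at h3
      rw [h3]

lemma two_mul_ncard_singular_notMem_perp (hQ : HasWittIndex Q m) (hα : Contained Q α) :
    2 * {y | Q y = 0 ∧ y ∉ perp Q α}.ncard + 2 ^ (finrank (ZMod 2) V - finrank (ZMod 2) α) =
      2 ^ finrank (ZMod 2) V := by
  have h1 := two_mul_ncard_singular_perp hQ (contained_bot (Q := Q))
  have h2 := two_mul_ncard_singular_perp hQ hα
  have h3 : {v ∈ (perp Q ⊥ : Set V) | Q v = 0} =
      {y | Q y = 0 ∧ y ∉ perp Q α} ∪ {v ∈ (perp Q α : Set V) | Q v = 0} := by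
    ext v
    have : v ∈ perp Q ⊥ := by
      intro w hw
      rw [(Submodule.mem_bot _).1 hw]
      exact polar_zero_left _ _
    simp only [Set.mem_union, Set.mem_ofPred_eq, SetLike.mem_coe]
    tauto
  have h4 : Disjoint {y | Q y = 0 ∧ y ∉ perp Q α} {v ∈ (perp Q α : Set V) | Q v = 0} := by
    rw [Set.disjoint_left]
    rintro v ⟨-, h⟩ ⟨h', -⟩
    exact h h'
  rw [h3, Set.ncard_union_eq h4, finrank_bot, Nat.sub_zero] at h1
  omega

/-- The number of cliques of the form `switchedClique Q α T y`, found by counting the pairs `(T, y)`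
that define each of them. -/
lemma ncard_switchedCliques (hQ : HasWittIndex Q m) (hn : finrank (ZMod 2) V = 2 * m + e) {k : ℕ}
    (hα : Contained Q α) (hk : finrank (ZMod 2) α + (k + 1) = m) :
    {D | ∃ T ∈ generators Q m α, ∃ y, (Q y = 0 ∧ y ∉ perp Q α) ∧
        D = switchedClique Q α T y}.ncard =
      (∏ i ∈ Finset.range (k + 1), (2 ^ (e + i) + 1)) * (2 ^ (e + m) - 2 ^ (e + (k + 1))) := by
  set Y := {y | Q y = 0 ∧ y ∉ perp Q α} with hYdef
  set C := {D | ∃ T ∈ generators Q m α, ∃ y, (Q y = 0 ∧ y ∉ perp Q α) ∧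
        D = switchedClique Q α T y} with hC
  have hcount := ncard_mul_eq_ncard_mul (s := generators Q m α ×ˢ Y) (t := C)
    (Set.toFinite _) (Set.toFinite _)
    (fun p D => D = switchedClique Q α p.1 p.2) (p := 1) (q := 2 ^ (m - 1)) ?_ ?_
  · rw [Set.ncard_prod, mul_one, ncard_generators hQ hn hα hk] at hcount
    have hY := two_mul_ncard_singular_notMem_perp hQ hα
    set a := finrank (ZMod 2) α
    have hle : 2 ^ (e + (k + 1)) ≤ 2 ^ (e + m) := Nat.pow_le_pow_right (by norm_num) (by omega)
    have hYcard : Y.ncard = 2 ^ (m - 1) * (2 ^ (e + m) - 2 ^ (e + (k + 1))) := by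
      rw [hn, show 2 * m + e - a = (m - 1) + (e + (k + 1)) + 1 by omega,
        show 2 * m + e = (m - 1) + (e + m) + 1 by omega] at hY
      zify [hle]
      zify at hY
      simp only [pow_add, pow_one] at hY ⊢
      linarith
    rw [hYcard] at hcount
    apply Nat.eq_of_mul_eq_mul_right (show 0 < 2 ^ (m - 1) by positivity)
    rw [← hcount]
    ring
  · rintro ⟨T, y⟩ ⟨hT, hy⟩
    rw [Set.ncard_eq_one]
    refine ⟨switchedClique Q α T y, ?_⟩
    ext D
    constructor
    · rintro ⟨-, h⟩; exact h
    · rintro rfl; exact ⟨⟨T, hT, y, hy, rfl⟩, rfl⟩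
  · rintro D ⟨T, hT, y, hy, rfl⟩
    obtain ⟨b, hbα, hb⟩ := exists_polar_eq_one hy.2
    have h1 := ncard_polar_eq_zero T (hT.2.2 hbα) hb
    rw [← ncard_translate_polar_eq_zero, hT.2.1] at h1
    have h2 : {p ∈ generators Q m α ×ˢ Y | switchedClique Q α T y = switchedClique Q α p.1 p.2} =
        (fun v => (T, v)) '' {v | v + y ∈ T ∧ polar Q v y = 0} := by
      ext ⟨T', y'⟩
      constructor
      · rintro ⟨⟨hT', hy'⟩, h⟩
        obtain ⟨rfl, h'⟩ := (switchedClique_eq_iff hα hT hT' hy.2 hy'.2).1 h.symm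
        exact ⟨y', h', rfl⟩
      · rintro ⟨v, hv, hv'⟩
        obtain ⟨rfl, rfl⟩ := Prod.mk.inj hv'
        have hvperp := notMem_perp_of_mem_coset hT.1 hT.2.2 hy.2 hv.1
        refine ⟨⟨hT, ?_, hvperp⟩, ((switchedClique_eq_iff hα hT hT hy.2 hvperp).2 ⟨rfl, hv⟩).symm⟩
        have h3 := hT.1 _ hv.1
        rwa [map_add_of_polar_eq_zero hv.2, hy.1, add_zero] at h3
    rw [h2, Set.ncard_image_of_injective _ (Prod.mk_right_injective T)]
    have h3 : 2 ^ m = 2 * 2 ^ (m - 1) := by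
      rw [← pow_succ', show m - 1 + 1 = m by omega]
    omega

/-- The number of cliques of the switched graph that are as large as the point set of a generator. -/
lemma ncard_isVectorClique_switchedRel (hQ : HasWittIndex Q m)
    (hn : finrank (ZMod 2) V = 2 * m + e) {k : ℕ} (hα : Contained Q α)
    (hk : finrank (ZMod 2) α + (k + 1) = m) :
    {D : Set V | IsVectorClique Q (switchedRel Q α) D ∧ D.ncard = 2 ^ m - 1}.ncard =
      (∏ i ∈ Finset.range (k + 1), (2 ^ (e + i) + 1)) *
        (2 ^ (e + m) - 2 ^ (e + (k + 1)) + 1) := by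
  have h1 : {D : Set V | IsVectorClique Q (switchedRel Q α) D ∧ D.ncard = 2 ^ m - 1} =
      (fun M : Submodule (ZMod 2) V => (M : Set V) \ {0}) '' generators Q m α ∪
      {D | ∃ T ∈ generators Q m α, ∃ y, (Q y = 0 ∧ y ∉ perp Q α) ∧
        D = switchedClique Q α T y} := by
    ext D
    constructor
    · rintro ⟨hD, h⟩
      rcases (hD.switched hQ hα (by omega)).2 h with ⟨M, hM, rfl⟩ | h
      · exact Or.inl ⟨M, hM, rfl⟩
      · exact Or.inr h
    · rintro (⟨M, hM, rfl⟩ | ⟨T, hT, y, hy, rfl⟩)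
      · refine ⟨⟨fun v hv => ⟨hv.2, hM.1 v hv.1⟩, fun u hu v hv _ => ?_⟩,
          by simp only [ncard_submodule_sdiff_zero, hM.2.1]⟩
        have hle := hM.1.le_perp.trans (perp_anti hM.2.2)
        exact (switchedRel_iff_of_mem_perp (hle hu.1) (hle hv.1)).2
          (hM.1.polar_eq_zero hu.1 hv.1)
      · exact ⟨isVectorClique_switchedClique hα hT hy.1 hy.2, ncard_switchedClique hT hy.2⟩
  have h2 : Disjoint ((fun M : Submodule (ZMod 2) V => (M : Set V) \ {0}) '' generators Q m α)
      {D | ∃ T ∈ generators Q m α, ∃ y, (Q y = 0 ∧ y ∉ perp Q α) ∧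
        D = switchedClique Q α T y} := by
    rw [Set.disjoint_left]
    rintro _ ⟨M, hM, rfl⟩ ⟨T, hT, y, hy, h⟩
    have h3 : y ∈ (M : Set V) \ {0} := by
      change (M : Set V) \ {0} = switchedClique Q α T y at h
      rw [h]
      exact mem_switchedClique_self T y
    exact hy.2 (perp_anti hM.2.2 (hM.1.le_perp h3.1))
  rw [h1, Set.ncard_union_eq h2 (Set.toFinite _) (Set.toFinite _),
    Set.ncard_image_of_injective _ submodule_sdiff_zero_injective, ncard_generators hQ hn hα hk,
    ncard_switchedCliques hQ hn hα hk]
  ring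

end

/-! ### Points of the quadric and singular vectors -/

section

variable {V : Type*} [AddCommGroup V] [Module (ZMod 2) V] [Finite V]
  {Q : QuadraticForm (ZMod 2) V} {m e : ℕ} {α : Submodule (ZMod 2) V}

/-- The unique non-zero vector of a point of the quadric over `𝔽₂`. -/
noncomputable def vec (P : Point Q) : V :=
  P.1.rep

omit [Finite V] in
lemma submodule_le_iff {P : Point Q} {W : Submodule (ZMod 2) V} :
    P.1.submodule ≤ W ↔ vec P ∈ W := by
  rw [Projectivization.submodule_eq, Submodule.span_singleton_le_iff_mem, vec]

omit [Finite V] in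
lemma vec_ne_zero (P : Point Q) : vec P ≠ 0 :=
  P.1.rep_nonzero

omit [Finite V] in
lemma map_vec (P : Point Q) : Q (vec P) = 0 :=
  P.2 _ (submodule_le_iff.1 le_rfl)

omit [Finite V] in
lemma vec_injective : Function.Injective (vec (Q := Q)) := by
  intro P P' h
  apply Subtype.ext
  apply Projectivization.submodule_injective
  rw [Projectivization.submodule_eq, Projectivization.submodule_eq]
  exact congrArg (fun v => Submodule.span (ZMod 2) {v}) h

omit [Finite V] in
lemma exists_vec_eq {v : V} (hv : v ≠ 0) (hv0 : Q v = 0) : ∃ P : Point Q, vec P = v := by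
  have h1 : Contained Q (Projectivization.mk (ZMod 2) v hv).submodule := by
    rw [Projectivization.submodule_mk]
    intro w hw
    rcases mem_span_singleton_zmod_two.1 hw with rfl | rfl
    · exact QuadraticMap.map_zero _
    · exact hv0
  refine ⟨⟨_, h1⟩, ?_⟩
  have h2 : vec (⟨_, h1⟩ : Point Q) ∈ (Projectivization.mk (ZMod 2) v hv).submodule :=
    submodule_le_iff.1 le_rfl
  rw [Projectivization.submodule_mk] at h2
  exact (mem_span_singleton_zmod_two.1 h2).resolve_left (vec_ne_zero _)

lemma pointGraph_adj {P P' : Point Q} :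
    (pointGraph Q).Adj P P' ↔ P ≠ P' ∧ orthRel Q (vec P) (vec P') := by
  refine and_congr_right fun hne => ?_
  constructor
  · rintro ⟨l, ⟨-, hl⟩, h1, h2⟩
    exact hl.polar_eq_zero (submodule_le_iff.1 h1) (submodule_le_iff.1 h2)
  · intro h
    have h1 : vec P ∉ Submodule.span (ZMod 2) {vec P'} := by
      rw [mem_span_singleton_zmod_two]
      rintro (h | h)
      · exact vec_ne_zero P h
      · exact hne (vec_injective h)
    have h2 : Contained Q (Submodule.span (ZMod 2) {vec P'}) := by
      intro v hv
      rcases mem_span_singleton_zmod_two.1 hv with rfl | rfl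
      · exact QuadraticMap.map_zero _
      · exact map_vec P'
    refine ⟨Submodule.span (ZMod 2) {vec P'} ⊔ Submodule.span (ZMod 2) {vec P}, ⟨?_, ?_⟩, ?_, ?_⟩
    · rw [finrank_sup_span_singleton h1, finrank_span_singleton (vec_ne_zero P')]
    · refine h2.sup_span_singleton ?_ (map_vec P)
      intro v hv
      change polar Q v (vec P) = 0
      rcases mem_span_singleton_zmod_two.1 hv with rfl | rfl
      · exact polar_zero_left _ _
      · rw [polar_comm]; exact h
    · exact submodule_le_iff.2 (Submodule.mem_sup_right (Submodule.mem_span_singleton_self _))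
    · exact submodule_le_iff.2 (Submodule.mem_sup_left (Submodule.mem_span_singleton_self _))

omit [Finite V] in
lemma isClique_iff_isVectorClique {G : SimpleGraph (Point Q)} {R : V → V → Prop}
    (hG : ∀ P P', G.Adj P P' ↔ P ≠ P' ∧ R (vec P) (vec P')) (C : Set (Point Q)) :
    G.IsClique C ↔ IsVectorClique Q R (vec '' C) := by
  constructor
  · intro h
    refine ⟨?_, ?_⟩
    · rintro _ ⟨P, -, rfl⟩
      exact ⟨vec_ne_zero P, map_vec P⟩
    · rintro _ ⟨P, hP, rfl⟩ _ ⟨P', hP', rfl⟩ hne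
      exact ((hG P P').1 (h hP hP' fun h => hne (congrArg vec h))).2
  · rintro ⟨-, h⟩ P hP P' hP' hne
    exact (hG P P').2 ⟨hne, h ⟨P, hP, rfl⟩ ⟨P', hP', rfl⟩ fun h => hne (vec_injective h)⟩

omit [Finite V] in
lemma IsVectorClique.image_preimage_vec {R : V → V → Prop} {D : Set V}
    (hD : IsVectorClique Q R D) : vec '' (vec (Q := Q) ⁻¹' D) = D := by
  refine Set.image_preimage_eq_of_subset fun v hv => ?_
  obtain ⟨h1, h2⟩ := hD.1 v hv
  exact exists_vec_eq h1 h2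

lemma numMaximumCliques_eq {G : SimpleGraph (Point Q)} {R : V → V → Prop}
    (hG : ∀ P P', G.Adj P P' ↔ P ≠ P' ∧ R (vec P) (vec P')) {N : ℕ}
    (hle : ∀ D, IsVectorClique Q R D → D.ncard ≤ N)
    (hex : ∃ D, IsVectorClique Q R D ∧ D.ncard = N) :
    numMaximumCliques G = {D | IsVectorClique Q R D ∧ D.ncard = N}.ncard := by
  classical
  have hcard : ∀ C : Finset (Point Q), (vec '' (C : Set (Point Q))).ncard = C.card := fun C => by
    rw [Set.ncard_image_of_injective _ vec_injective, Set.ncard_coe_finset]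
  have hfin : ∀ D, IsVectorClique Q R D →
      ∃ C : Finset (Point Q), vec '' (C : Set (Point Q)) = D := fun D hD =>
    ⟨(Set.toFinite (vec (Q := Q) ⁻¹' D)).toFinset, by
      rw [Set.Finite.coe_toFinset, hD.image_preimage_vec]⟩
  have hmax : ∀ C : Finset (Point Q), G.IsMaximumClique C ↔
      IsVectorClique Q R (vec '' (C : Set (Point Q))) ∧
        (vec '' (C : Set (Point Q))).ncard = N := by
    intro C
    rw [SimpleGraph.isMaximumClique_iff, isClique_iff_isVectorClique hG]
    refine and_congr_right fun hC => ⟨fun h => ?_, fun h C' hC' => ?_⟩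
    · obtain ⟨D, hD, hDN⟩ := hex
      obtain ⟨C', rfl⟩ := hfin D hD
      have := h C' ((isClique_iff_isVectorClique hG _).2 hD)
      rw [← hcard, ← hcard, hDN] at this
      exact le_antisymm (hle _ hC) this
    · rw [← hcard, ← hcard, h]
      exact hle _ ((isClique_iff_isVectorClique hG _).1 hC')
  refine Set.ncard_congr (fun C _ => vec '' (C : Set (Point Q))) (fun C hC => (hmax C).1 hC) ?_ ?_
  · intro C C' _ _ h
    exact Finset.coe_injective (Set.image_injective.2 vec_injective h)
  · intro D hD
    obtain ⟨C, rfl⟩ := hfin D hD.1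
    exact ⟨C, (hmax C).2 hD, rfl⟩

lemma numInclusionMaximalCliques_eq {G : SimpleGraph (Point Q)} {R : V → V → Prop}
    (hG : ∀ P P', G.Adj P P' ↔ P ≠ P' ∧ R (vec P) (vec P')) :
    numInclusionMaximalCliques G = {D | Maximal (IsVectorClique Q R) D}.ncard := by
  refine Set.ncard_congr (fun C _ => vec '' C) ?_ ?_ ?_
  · intro C hC
    refine ⟨(isClique_iff_isVectorClique hG _).1 hC.1, fun D hD h => ?_⟩
    obtain ⟨C', rfl⟩ : ∃ C', vec '' C' = D := ⟨_, hD.image_preimage_vec⟩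
    exact Set.image_mono (hC.2 ((isClique_iff_isVectorClique hG _).2 hD)
      ((Set.image_subset_image_iff vec_injective).1 h))
  · intro C C' _ _ h
    exact Set.image_injective.2 vec_injective h
  · intro D hD
    refine ⟨vec ⁻¹' D, ⟨?_, fun C hC h => ?_⟩, hD.1.image_preimage_vec⟩
    · rw [isClique_iff_isVectorClique hG, hD.1.image_preimage_vec]
      exact hD.1
    · have h1 := hD.2 ((isClique_iff_isVectorClique hG _).1 hC)
        (by rw [← hD.1.image_preimage_vec]; exact Set.image_mono h)
      exact Set.image_subset_iff.1 h1

/-! ### The switched graph in terms of vectors -/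

lemma mem_typeTwo {s : ℕ} (hα : IsSpaceOn Q s α) {P : Point Q} :
    P ∈ typeTwo Q s α ↔ vec P ∈ perp Q α ∧ vec P ∉ α := by
  have h0 : P ∈ typeTwo Q s α ↔ ¬ P.1.submodule ≤ α ∧
    ∃ W : Submodule (ZMod 2) V, IsSpaceOn Q (s + 1) W ∧ α ≤ W ∧ P.1.submodule ≤ W := Iff.rfl
  rw [h0, submodule_le_iff, and_comm]
  refine and_congr_left fun hP => ?_
  constructor
  · rintro ⟨W, ⟨-, hW⟩, h1, h2⟩
    exact perp_anti h1 (hW.le_perp (submodule_le_iff.1 h2))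
  · intro h
    refine ⟨α ⊔ Submodule.span (ZMod 2) {vec P}, ⟨?_, hα.2.sup_span_singleton h (map_vec P)⟩,
      le_sup_left, submodule_le_iff.2 (Submodule.mem_sup_right (Submodule.mem_span_singleton_self _))⟩
    rw [finrank_sup_span_singleton hP, hα.1]

/-- The points that are joined to exactly half of the points of type (ii) are those outside `α^⊥`:
points of `α` are joined to all of them, and `polar Q · y` is balanced on each coset of `α` when
`y ∉ α^⊥`. -/
lemma halfJoined_iff {s : ℕ} (hQ : HasWittIndex Q m) (hα : IsSpaceOn Q s α)
    (hαm : finrank (ZMod 2) α < m) {P P' : Point Q} :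
    HalfJoined (pointGraph Q) (typeTwo Q s α) P P' ↔
      vec P ∈ perp Q α ∧ vec P ∉ α ∧ vec P' ∉ perp Q α := by
  set X : Set V := {x | Q x = 0 ∧ x ∈ perp Q α ∧ x ∉ α} with hX
  have himage : vec '' typeTwo Q s α = X := by
    ext x
    constructor
    · rintro ⟨P, hP, rfl⟩
      exact ⟨map_vec P, (mem_typeTwo hα).1 hP⟩
    · rintro ⟨h1, h2⟩
      have hx0 : x ≠ 0 := by rintro rfl; exact h2.2 (zero_mem α)
      obtain ⟨P, rfl⟩ := exists_vec_eq hx0 h1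
      exact ⟨P, (mem_typeTwo hα).2 h2, rfl⟩
  have hcard : (typeTwo Q s α).ncard = X.ncard := by
    rw [← himage, Set.ncard_image_of_injective _ vec_injective]
  have hXpos : 0 < X.ncard := by
    rw [Set.ncard_pos]
    obtain ⟨M, hM, hMm⟩ := hQ.exists_finrank_eq
    obtain ⟨v, hv, hv1, hv2⟩ := exists_mem_perp_notMem hQ.nonsingular hα.2 hM (by omega)
    exact ⟨v, hM v hv, hv1, hv2⟩
  have hnbr : P' ∉ typeTwo Q s α →
      ((pointGraph Q).neighborSet P' ∩ typeTwo Q s α).ncard =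
        {x ∈ X | polar Q x (vec P') = 0}.ncard := by
    intro hP'
    rw [← Set.ncard_image_of_injective _ (vec_injective (Q := Q)), ← himage]
    congr 1
    ext x
    constructor
    · rintro ⟨P, ⟨h1, h2⟩, rfl⟩
      refine ⟨⟨P, h2, rfl⟩, ?_⟩
      rw [polar_comm]
      exact (pointGraph_adj.1 h1).2
    · rintro ⟨⟨P, h1, rfl⟩, h2⟩
      rw [polar_comm] at h2
      exact ⟨P, ⟨pointGraph_adj.2 ⟨fun h => hP' (h ▸ h1), h2⟩, h1⟩, rfl⟩
  unfold HalfJoined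
  rw [mem_typeTwo hα, and_assoc, hcard]
  refine and_congr_right fun _ => and_congr_right fun _ => ?_
  constructor
  · rintro ⟨h1, h2⟩ h3
    have h4 : vec P' ∈ α := by
      by_contra h4
      exact h1 ((mem_typeTwo hα).2 ⟨h3, h4⟩)
    rw [hnbr h1] at h2
    have h5 : {x ∈ X | polar Q x (vec P') = 0} = X := by
      refine Set.sep_eq_self_iff_mem_true.2 fun x hx => ?_
      rw [polar_comm]
      exact hx.2.1 _ h4
    rw [h5] at h2
    omega
  · intro h
    have h1 : P' ∉ typeTwo Q s α := fun h' => h ((mem_typeTwo hα).1 h').1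
    refine ⟨h1, ?_⟩
    rw [hnbr h1]
    obtain ⟨b, hbα, hb⟩ := exists_polar_eq_one h
    refine two_mul_ncard_polar_eq_zero hb ?_
    rintro x ⟨hx1, hx2, hx3⟩
    refine ⟨?_, add_mem hx2 (hα.2.le_perp hbα), fun h => hx3 ?_⟩
    · rw [add_comm, map_add_of_polar_eq_zero (hx2 b hbα), hx1, hα.2 b hbα, add_zero]
    · simpa using sub_mem h hbα

lemma switchedGraph_adj {s : ℕ} (hQ : HasWittIndex Q m) (hα : IsSpaceOn Q s α)
    (hαm : finrank (ZMod 2) α < m) {P P' : Point Q} :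
    (switchedGraph Q s α).Adj P P' ↔ P ≠ P' ∧ switchedRel Q α (vec P) (vec P') := by
  have h0 : (switchedGraph Q s α).Adj P P' ↔ Xor ((pointGraph Q).Adj P P')
    (HalfJoined (pointGraph Q) (typeTwo Q s α) P P' ∨
      HalfJoined (pointGraph Q) (typeTwo Q s α) P' P) := Iff.rfl
  rw [h0, halfJoined_iff hQ hα hαm, halfJoined_iff hQ hα hαm, pointGraph_adj]
  unfold switchedRel orthRel
  rcases eq_or_ne P P' with rfl | hne
  · unfold Xor; tauto
  · simp only [ne_eq, hne, not_false_eq_true, true_and]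

/-! ### The numbers of cliques in terms of the Witt index -/

omit [Finite V] in
lemma IsProjectiveIndex.hasWittIndex {g : ℕ} (hg : IsProjectiveIndex Q g) (hQ : IsNonsingular Q) :
    HasWittIndex Q (g + 1) := by
  refine ⟨hQ, fun W hW => ?_, ?_⟩
  · rcases Nat.eq_zero_or_pos (finrank (ZMod 2) W) with h | h
    · omega
    · have := hg.2 (show finrank (ZMod 2) W - 1 ∈ {k | ∃ W, IsSpaceOn Q k W} from
        ⟨W, by omega, hW⟩)
      omega
  · obtain ⟨W, h1, h2⟩ := hg.1
    exact ⟨W, h2, h1⟩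

lemma numMaximumCliques_pointGraph (hQ : HasWittIndex Q m)
    (hn : finrank (ZMod 2) V = 2 * m + e) :
    numMaximumCliques (pointGraph Q) = ∏ i ∈ Finset.range m, (2 ^ (e + i) + 1) := by
  obtain ⟨M, hM⟩ := exists_generator hQ (contained_bot (Q := Q))
  rw [numMaximumCliques_eq (fun _ _ => pointGraph_adj) (N := 2 ^ m - 1)
      (fun D hD => hD.ncard_le hQ)
      ⟨_, hM.1.isVectorClique, by rw [ncard_submodule_sdiff_zero, hM.2.1]⟩,
    setOf_isVectorClique_orthRel hQ, Set.ncard_image_of_injective _ submodule_sdiff_zero_injective,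
    ncard_generators_bot hQ hn]

lemma numInclusionMaximalCliques_pointGraph (hQ : HasWittIndex Q m)
    (hn : finrank (ZMod 2) V = 2 * m + e) :
    numInclusionMaximalCliques (pointGraph Q) = ∏ i ∈ Finset.range m, (2 ^ (e + i) + 1) := by
  rw [numInclusionMaximalCliques_eq (fun _ _ => pointGraph_adj),
    setOf_maximal_isVectorClique_orthRel hQ,
    Set.ncard_image_of_injective _ submodule_sdiff_zero_injective, ncard_generators_bot hQ hn]

lemma numMaximumCliques_switchedGraph {s k : ℕ} (hQ : HasWittIndex Q m)
    (hn : finrank (ZMod 2) V = 2 * m + e) (hα : IsSpaceOn Q s α) (hk : s + k + 2 = m) :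
    numMaximumCliques (switchedGraph Q s α) =
      (∏ i ∈ Finset.range (k + 1), (2 ^ (e + i) + 1)) *
        (2 ^ (e + m) - 2 ^ (e + (k + 1)) + 1) := by
  have hα1 := hα.1
  have hαm : finrank (ZMod 2) α < m := by omega
  have hcount := ncard_isVectorClique_switchedRel hQ hn hα.2 (k := k) (by omega)
  rw [← hcount]
  refine numMaximumCliques_eq (fun _ _ => switchedGraph_adj hQ hα hαm)
    (fun D hD => (hD.switched hQ hα.2 hαm).1) ?_
  have hpos : 0 < {D : Set V | IsVectorClique Q (switchedRel Q α) D ∧ D.ncard = 2 ^ m - 1}.ncard := by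
    rw [hcount]; positivity
  exact Set.nonempty_of_ncard_ne_zero hpos.ne'

end

lemma prod_Icc_eq_prod_range {a b k : ℕ} (h : b + 1 = a + k) (f : ℕ → ℕ) :
    ∏ i ∈ Finset.Icc a b, f i = ∏ i ∈ Finset.range k, f (a + i) := by
  rw [← Finset.Ico_add_one_right_eq_Icc, h, Finset.prod_Ico_eq_prod_range, Nat.add_sub_cancel_left]

end QuadricGraph

open QuadricGraph in
theorem theorem4p7 {V : Type*} [AddCommGroup V] [Module (ZMod 2) V] [Finite V]
    (Q : QuadraticForm (ZMod 2) V) (g : ℕ)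
    (hg : QuadricGraph.IsProjectiveIndex Q g) (hg1 : 1 ≤ g) (r : ℕ) :
    (QuadricGraph.IsElliptic Q r →
      (QuadricGraph.numMaximumCliques (QuadricGraph.pointGraph Q)
          = ∏ i ∈ Finset.Icc 2 (r + 1), (2 ^ i + 1) ∧
        QuadricGraph.numInclusionMaximalCliques (QuadricGraph.pointGraph Q)
          = ∏ i ∈ Finset.Icc 2 (r + 1), (2 ^ i + 1)) ∧
      ∀ (s : ℕ) (α : Submodule (ZMod 2) V), s < g → QuadricGraph.IsSpaceOn Q s α →
        QuadricGraph.numMaximumCliques (QuadricGraph.switchedGraph Q s α)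
          = (∏ i ∈ Finset.Icc 2 (r - s), (2 ^ i + 1)) * (2 ^ (r + 2) - 2 ^ (r - s + 1) + 1)) ∧
    (QuadricGraph.IsHyperbolic Q r →
      (QuadricGraph.numMaximumCliques (QuadricGraph.pointGraph Q)
          = ∏ i ∈ Finset.Icc 0 r, (2 ^ i + 1) ∧
        QuadricGraph.numInclusionMaximalCliques (QuadricGraph.pointGraph Q)
          = ∏ i ∈ Finset.Icc 0 r, (2 ^ i + 1)) ∧
      ∀ (s : ℕ) (α : Submodule (ZMod 2) V), s < g → QuadricGraph.IsSpaceOn Q s α →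
        QuadricGraph.numMaximumCliques (QuadricGraph.switchedGraph Q s α)
          = (∏ i ∈ Finset.Icc 0 (r - s - 1), (2 ^ i + 1)) * (2 ^ (r + 1) - 2 ^ (r - s) + 1)) ∧
    (QuadricGraph.IsParabolic Q r →
      (QuadricGraph.numMaximumCliques (QuadricGraph.pointGraph Q)
          = ∏ i ∈ Finset.Icc 1 r, (2 ^ i + 1) ∧
        QuadricGraph.numInclusionMaximalCliques (QuadricGraph.pointGraph Q)
          = ∏ i ∈ Finset.Icc 1 r, (2 ^ i + 1)) ∧
      ∀ (s : ℕ) (α : Submodule (ZMod 2) V), s < g → QuadricGraph.IsSpaceOn Q s α →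
        QuadricGraph.numMaximumCliques (QuadricGraph.switchedGraph Q s α)
          = (∏ i ∈ Finset.Icc 1 (r - s - 1), (2 ^ i + 1)) * (2 ^ (r + 1) - 2 ^ (r - s) + 1)) := by
  refine ⟨?_, ?_, ?_⟩
  · rintro ⟨hdim, hQ, hr, hg'⟩
    have hgr : g = r - 1 := hg.unique hg'
    have hW := hg.hasWittIndex hQ
    have hn : Module.finrank (ZMod 2) V = 2 * (g + 1) + 2 := by omega
    refine ⟨⟨?_, ?_⟩, fun s α hs hα => ?_⟩
    · rw [numMaximumCliques_pointGraph hW hn, prod_Icc_eq_prod_range (k := g + 1) (by omega)]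
    · rw [numInclusionMaximalCliques_pointGraph hW hn,
        prod_Icc_eq_prod_range (k := g + 1) (by omega)]
    · obtain ⟨k, rfl⟩ := Nat.exists_eq_add_of_lt hs
      rw [numMaximumCliques_switchedGraph (k := k) hW hn hα (by omega),
        prod_Icc_eq_prod_range (k := k + 1) (by omega),
        show 2 + (s + k + 1 + 1) = r + 2 by omega, show 2 + (k + 1) = r - s + 1 by omega]
  · rintro ⟨hdim, hQ, hg'⟩
    have hgr : g = r := hg.unique hg'
    have hW := hg.hasWittIndex hQ
    have hn : Module.finrank (ZMod 2) V = 2 * (g + 1) + 0 := by omega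
    refine ⟨⟨?_, ?_⟩, fun s α hs hα => ?_⟩
    · rw [numMaximumCliques_pointGraph hW hn, prod_Icc_eq_prod_range (k := g + 1) (by omega)]
    · rw [numInclusionMaximalCliques_pointGraph hW hn,
        prod_Icc_eq_prod_range (k := g + 1) (by omega)]
    · obtain ⟨k, rfl⟩ := Nat.exists_eq_add_of_lt hs
      rw [numMaximumCliques_switchedGraph (k := k) hW hn hα (by omega),
        prod_Icc_eq_prod_range (k := k + 1) (by omega),
        show 0 + (s + k + 1 + 1) = r + 1 by omega, show 0 + (k + 1) = r - s by omega]
  · rintro ⟨hdim, hQ⟩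
    have hW := hg.hasWittIndex hQ
    have h1 := hW.two_mul_le
    have h2 := hW.finrank_le_two_mul_add_two
    have hn : Module.finrank (ZMod 2) V = 2 * (g + 1) + 1 := by omega
    refine ⟨⟨?_, ?_⟩, fun s α hs hα => ?_⟩
    · rw [numMaximumCliques_pointGraph hW hn, prod_Icc_eq_prod_range (k := g + 1) (by omega)]
    · rw [numInclusionMaximalCliques_pointGraph hW hn,
        prod_Icc_eq_prod_range (k := g + 1) (by omega)]
    · obtain ⟨k, rfl⟩ := Nat.exists_eq_add_of_lt hs
      rw [numMaximumCliques_switchedGraph (k := k) hW hn hα (by omega),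
        prod_Icc_eq_prod_range (k := k + 1) (by omega),
        show 1 + (s + k + 1 + 1) = r + 1 by omega, show 1 + (k + 1) = r - s by omega]
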